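/- Let $q\in\mathbb C\setminus\{0\}$ be not a root of unity and let $A=\mathbb C_q[S^2]$ be the standard Podleś quantum sphere: the universal unital associative $\mathbb C$-algebra generated by $x_{-1},x_0,x_1$ with relations $$x_{\pm1}x_0=q^{\mp2}x_0x_{\pm1},\qquad x_{\pm1}x_{\mp1}=q^{\mp2}x_0^2+q^{\mp1}x_0 .$$ Let $G=\mathrm{Aut}(A)$. For $\sigma\in G$ let ${}_\sigma A$ be the bimodule $A$ with $a\triangleright b\triangleleft c=\sigma(a)bc$, and let $H^n(A,{}_\sigma A)$ be its Hochschild cohomology, computed from the complex $\mathrm{Hom}_{\mathbb C}(A^{\otimes n},A)$ with $$(\mathrm b\psi)(a_0,\dots,a_n)=\sigma(a_0)\psi(a_1,\dots,a_n)+\sum_{i=0}^{n-1}(-1)^{i+1}\psi(\dots,a_ia_{i+1},\dots)+(-1)^{n+1}\psi(a_0,\dots,a_{n-1})a_n .$$ Let $\Lambda_G(A)=\bigoplus_{n\ge0,\ \sigma\in G}H^n(A,{}_\sigma A)$, an $\mathbb N\times G$-graded $\mathbb C$-algebra under the cup product $\smallsmile: H^m(A,{}_\sigma A)\otimes H^n(A,{}_\tau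 A)\to H^{m+n}(A,{}_{\tau\circ\sigma}A)$ induced by $$(\varphi\smallsmile\psi)(a_1,\dots,a_{m+n})=\tau(\varphi(a_1,\dots,a_m))\,\psi(a_{m+1},\dots,a_{m+n}).$$ Let $\sigma_{\mathrm{mod}}\in G$ be given by $\sigma_{\mathrm{mod}}(x_n)=q^{2n}x_n$, and for $i\in\{-1,0,1\}$ let $\partial_i:A\to A$ be the unique linear map with $\partial_i(ab)=\sigma_{\mathrm{mod}}^{-|i|}(a)\,\partial_i(b)+\partial_i(a)\,b$ and $$\partial_1:(x_{-1},x_0,x_1)\mapsto(0,\ qx_{-1},\ 1+(q+q^{-1})x_0),\qquad \partial_0:(x_{-1},x_0,x_1)\mapsto(-x_{-1},\ 0,\ x_1),$$ $$\partial_{-1}:(x_{-1},x_0,x_1)\mapsto(1+(q+q^{-1})x_0,\ q^{-1}x_1,\ 0),$$ with class $[\partial_i]\in H^1(A,{}_{\sigma_{\mathrm{mod}}^{-|i|}}A)$. Then: 1. $[\partial_i]\smallsmile[\partial_j]=-q^{2ij}\,[\partial_j]\smallsmile[\partial_i]$ for all $i\le j$ in $\{-1,0,1\}$. In particular $[\partial_i]\smallsmile[\partial_i]=0$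 for all $i$, and $[\partial_1]\smallsmile[\partial_{-1}]+q^2[\partial_{-1}]\smallsmile[\partial_1]=0$. 2. The classes $[\partial_i]$ satisfy no other relations in cohomological degrees up to $2$, and their threefold products vanish: the kernel of the unital $\mathbb C$-algebra homomorphism $\mathbb C\langle y_{-1},y_0,y_1\rangle\to\Lambda_G(A)$, $y_i\mapsto[\partial_i]$, is the two-sided ideal generated by $y_iy_j+q^{2ij}y_jy_i$ ($i\le j$) and $y_{-1}y_0y_1$. Thus the subalgebra of $\Lambda_G(A)$ generated by the $[\partial_i]$ is the quantum exterior algebra on three generators given by the relations in 1, divided by its one-dimensional part of degree $3$. -/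

import Mathlib

namespace TwistedHochschild

section Complex

variable (k : Type*) [Field k] (A : Type*) [Ring A] [Algebra k A]

/-- `n`-cochains `Hom_k(A^{⊗ n}, A)`, written as `k`-multilinear maps in `n` arguments. -/
abbrev Cochain (n : ℕ) : Type _ := MultilinearMap k (fun _ : Fin n => A) A

/-- The usual additive group structure on cochains, with the instance fields unfolded so that
subquotients of the space of cochains are found by type class synthesis. -/
instance Cochain.instAddCommGroup (n : ℕ) : AddCommGroup (Cochain k A n) where
  __ := (MultilinearMap.addCommMonoid : AddCommMonoid (Cochain k A n))
  neg := Neg.neg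
  sub := Sub.sub
  zsmul c φ := c • φ
  sub_eq_add_neg := sub_eq_add_neg
  zsmul_zero' := SubNegMonoid.zsmul_zero'
  zsmul_succ' := SubNegMonoid.zsmul_succ'
  zsmul_neg' := SubNegMonoid.zsmul_neg'
  neg_add_cancel := neg_add_cancel

variable {k A}

theorem contractNth_update {n : ℕ} (j : Fin n) (a : Fin (n + 1) → A) (i : Fin (n + 1)) :
    ∃ (i' : Fin n) (L : A →ₗ[k] A), ∀ x : A,
      Fin.contractNth j.castSucc (· * ·) (Function.update a i x) =
        Function.update (Fin.contractNth j.castSucc (· * ·) a) i' (L x) := by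
  rcases lt_trichotomy (i : ℕ) j with h | h | h
  · refine ⟨⟨i, by omega⟩, LinearMap.id, fun x => funext fun l => ?_⟩
    simp only [Fin.contractNth, Function.update_apply, Fin.ext_iff, Fin.val_castSucc, Fin.val_succ]
    split_ifs <;> first | rfl | omega
  · refine ⟨⟨i, by omega⟩, LinearMap.mulRight k (a j.succ), fun x => funext fun l => ?_⟩
    simp only [Fin.contractNth, Function.update_apply, Fin.ext_iff, Fin.val_castSucc, Fin.val_succ]
    split_ifs with h1 h2 h3 h4 h5
    all_goals first | rfl | omega | skip
    all_goals
      have : l = j := Fin.ext (by omega)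
      subst this; simp
  · by_cases h' : (i : ℕ) = j + 1
    · refine ⟨j, LinearMap.mulLeft k (a j.castSucc), fun x => funext fun l => ?_⟩
      simp only [Fin.contractNth, Function.update_apply, Fin.ext_iff, Fin.val_castSucc,
        Fin.val_succ]
      split_ifs
      all_goals first | rfl | omega | skip
      all_goals
        have : l = j := Fin.ext (by omega)
        subst this; simp
    · refine ⟨⟨i - 1, by omega⟩, LinearMap.id, fun x => funext fun l => ?_⟩
      simp only [Fin.contractNth, Function.update_apply, Fin.ext_iff, Fin.val_castSucc,
        Fin.val_succ]
      split_ifs <;> first | rfl | omega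

/-- `(a_0, …, a_n) ↦ ψ(a_0, …, a_j a_{j+1}, …, a_n)`. -/
def innerFace {n : ℕ} (j : Fin n) (ψ : Cochain k A n) : Cochain k A (n + 1) where
  toFun a := ψ (Fin.contractNth j.castSucc (· * ·) a)
  map_update_add' {inst} a i x y := by
    obtain rfl : inst = instDecidableEqFin _ := Subsingleton.elim _ _
    obtain ⟨i', L, h⟩ := contractNth_update (k := k) j a i
    rw [h, h, h, map_add, ψ.map_update_add]
  map_update_smul' {inst} a i c x := by
    obtain rfl : inst = instDecidableEqFin _ := Subsingleton.elim _ _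
    obtain ⟨i', L, h⟩ := contractNth_update (k := k) j a i
    rw [h, h, map_smul, ψ.map_update_smul]

/-- `(a_0, …, a_n) ↦ σ(a_0) ψ(a_1, …, a_n)`. -/
def firstFace (σ : A ≃ₐ[k] A) {n : ℕ} (ψ : Cochain k A n) : Cochain k A (n + 1) :=
  LinearMap.uncurryLeft
    { toFun := fun x => (LinearMap.mulLeft k (σ x)).compMultilinearMap ψ
      map_add' := fun x y => by ext; simp [add_mul]
      map_smul' := fun c x => by ext; simp }

/-- `(a_0, …, a_n) ↦ ψ(a_0, …, a_{n-1}) a_n`. -/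
def lastFace {n : ℕ} (ψ : Cochain k A n) : Cochain k A (n + 1) :=
  MultilinearMap.uncurryRight ((LinearMap.mul k A).compMultilinearMap ψ)

/-- The Hochschild coboundary of cochains with coefficients in the bimodule `_σ A`:
`(b ψ)(a_0, …, a_n) = σ(a_0) ψ(a_1, …, a_n) + ∑_{j < n} (-1)^{j+1} ψ(…, a_j a_{j+1}, …)
  + (-1)^{n+1} ψ(a_0, …, a_{n-1}) a_n`. -/
def coboundary (σ : A ≃ₐ[k] A) (n : ℕ) : Cochain k A n →ₗ[k] Cochain k A (n + 1) where
  toFun ψ := firstFace σ ψ + ∑ j : Fin n, (-1 : k) ^ ((j : ℕ) + 1) • innerFace j ψ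
    + (-1 : k) ^ (n + 1) • lastFace ψ
  map_add' φ ψ := by
    ext a
    simp [firstFace, innerFace, lastFace, Finset.sum_add_distrib]
    abel
  map_smul' c ψ := by
    ext a
    simp [firstFace, innerFace, lastFace, Finset.smul_sum, smul_smul, mul_comm c]

theorem coboundary_apply (σ : A ≃ₐ[k] A) (n : ℕ) (ψ : Cochain k A n) (a : Fin (n + 1) → A) :
    coboundary σ n ψ a = σ (a 0) * ψ (Fin.tail a)
      + ∑ j : Fin n, (-1 : k) ^ ((j : ℕ) + 1) • ψ (Fin.contractNth j.castSucc (· * ·) a)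
      + (-1 : k) ^ (n + 1) • (ψ (Fin.init a) * a (Fin.last n)) := by
  simp [coboundary, firstFace, innerFace, lastFace]

/-- `n`-cocycles with coefficients in `_σ A`. -/
abbrev cocycles (σ : A ≃ₐ[k] A) (n : ℕ) : Submodule k (Cochain k A n) :=
  LinearMap.ker (coboundary σ n)

/-- `n`-coboundaries with coefficients in `_σ A` (there are none but `0` for `n = 0`). -/
def coboundaries (σ : A ≃ₐ[k] A) : (n : ℕ) → Submodule k (Cochain k A n)
  | 0 => ⊥
  | n + 1 => LinearMap.range (coboundary σ n)

/-- The Hochschild cohomology `H^n(A, _σ A)`: cocycles modulo coboundaries. -/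
def HH (σ : A ≃ₐ[k] A) (n : ℕ) : Type _ :=
  cocycles σ n ⧸ (coboundaries σ n).comap (cocycles σ n).subtype

instance (σ : A ≃ₐ[k] A) (n : ℕ) : AddCommGroup (HH σ n) :=
  inferInstanceAs (AddCommGroup (cocycles σ n ⧸ (coboundaries σ n).comap (cocycles σ n).subtype))

instance (σ : A ≃ₐ[k] A) (n : ℕ) : Module k (HH σ n) :=
  inferInstanceAs (Module k (cocycles σ n ⧸ (coboundaries σ n).comap (cocycles σ n).subtype))

/-- The class in `H^n(A, _σ A)` of a cocycle. -/
def HH.mk (σ : A ≃ₐ[k] A) (n : ℕ) : cocycles σ n →ₗ[k] HH σ n :=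
  Submodule.mkQ ((coboundaries σ n).comap (cocycles σ n).subtype)

theorem HH.mk_surjective (σ : A ≃ₐ[k] A) (n : ℕ) : Function.Surjective (HH.mk σ n) :=
  Submodule.mkQ_surjective _

theorem HH.mk_eq_zero (σ : A ≃ₐ[k] A) (n : ℕ) (φ : cocycles σ n) :
    HH.mk σ n φ = 0 ↔ φ.1 ∈ coboundaries σ n :=
  Submodule.Quotient.mk_eq_zero _

/-- Linear maps out of `H^n(A, _σ A)`. -/
def HH.lift {M : Type*} [AddCommGroup M] [Module k M] (σ : A ≃ₐ[k] A) (n : ℕ)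
    (f : cocycles σ n →ₗ[k] M) (hf : ∀ φ : cocycles σ n, φ.1 ∈ coboundaries σ n → f φ = 0) :
    HH σ n →ₗ[k] M :=
  Submodule.liftQ ((coboundaries σ n).comap (cocycles σ n).subtype) f fun φ hφ => hf φ hφ

theorem HH.lift_mk {M : Type*} [AddCommGroup M] [Module k M] (σ : A ≃ₐ[k] A) (n : ℕ)
    (f : cocycles σ n →ₗ[k] M) (hf : ∀ φ : cocycles σ n, φ.1 ∈ coboundaries σ n → f φ = 0)
    (φ : cocycles σ n) : HH.lift σ n f hf (HH.mk σ n φ) = f φ :=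
  rfl

theorem HH.hom_ext {M : Type*} [AddCommGroup M] [Module k M] {σ : A ≃ₐ[k] A} {n : ℕ}
    {f g : HH σ n →ₗ[k] M} (h : ∀ φ, f (HH.mk σ n φ) = g (HH.mk σ n φ)) : f = g :=
  LinearMap.ext fun x => by
    obtain ⟨φ, rfl⟩ := HH.mk_surjective σ n x
    exact h φ

/-- The cup product of cochains, for `τ` the twist of the second factor:
`(φ ⌣ ψ)(a_1, …, a_{m+n}) = τ(φ(a_1, …, a_m)) ψ(a_{m+1}, …, a_{m+n})`. -/
def cup (τ : A ≃ₐ[k] A) {m n : ℕ} (φ : Cochain k A m) (ψ : Cochain k A n) :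
    Cochain k A (m + n) :=
  ((LinearMap.mul' k A).compMultilinearMap
    ((τ.toLinearMap.compMultilinearMap φ).domCoprod ψ)).domDomCongr finSumFinEquiv

theorem cup_apply (τ : A ≃ₐ[k] A) {m n : ℕ} (φ : Cochain k A m) (ψ : Cochain k A n)
    (a : Fin (m + n) → A) :
    cup τ φ ψ a = τ (φ fun i => a (Fin.castAdd n i)) * ψ fun i => a (Fin.natAdd m i) := by
  simp [cup]

/-- Contraction of two neighbouring entries of a sequence. -/
def contractSeq (j : ℕ) (s : ℕ → A) (i : ℕ) : A :=
  if i < j then s i else if i = j then s i * s (i + 1) else s (i + 1)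

theorem coboundary_seq (σ : A ≃ₐ[k] A) (n : ℕ) (ψ : Cochain k A n) (s : ℕ → A) :
    coboundary σ n ψ (fun i : Fin (n + 1) => s i) = σ (s 0) * ψ (fun i => s (i + 1))
      + ∑ j : Fin n, (-1 : k) ^ ((j : ℕ) + 1) • ψ (fun i => contractSeq j s i)
      + (-1 : k) ^ (n + 1) • (ψ (fun i => s i) * s n) := by
  rw [coboundary_apply]
  rfl

theorem cup_seq (τ : A ≃ₐ[k] A) {m n : ℕ} (φ : Cochain k A m) (ψ : Cochain k A n) (s : ℕ → A) :
    cup τ φ ψ (fun i : Fin (m + n) => s i) = τ (φ fun i => s i) * ψ fun i => s (m + i) := by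
  rw [cup_apply]
  rfl

/-- A cochain of degree `m`, regarded as a cochain of degree `n = m`. -/
def castCochain {m n : ℕ} (h : m = n) (φ : Cochain k A m) : Cochain k A n :=
  φ.domDomCongr (finCongr h)

theorem castCochain_seq {m n : ℕ} (h : m = n) (φ : Cochain k A m) (s : ℕ → A) :
    castCochain h φ (fun i : Fin n => s i) = φ (fun i : Fin m => s i) := by
  subst h
  rfl

theorem exists_seq {n : ℕ} (a : Fin n → A) : ∃ s : ℕ → A, a = fun i : Fin n => s i :=
  ⟨fun i => if h : i < n then a ⟨i, h⟩ else 0, by ext i; simp⟩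

theorem cochain_ext {n : ℕ} {φ ψ : Cochain k A n}
    (h : ∀ s : ℕ → A, φ (fun i : Fin n => s i) = ψ (fun i : Fin n => s i)) : φ = ψ := by
  ext a
  obtain ⟨s, rfl⟩ := exists_seq a
  exact h s

theorem coboundary_cup (σ τ : A ≃ₐ[k] A) {m n : ℕ} (φ : Cochain k A m) (ψ : Cochain k A n) :
    coboundary (τ * σ) (m + n) (cup τ φ ψ) =
      castCochain (by omega) (cup τ (coboundary σ m φ) ψ)
        + (-1 : k) ^ m • cup τ φ (coboundary τ n ψ) := by
  refine cochain_ext fun s => ?_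
  have e1 := (castCochain_seq (show m + 1 + n = m + n + 1 by omega)
    (cup τ (coboundary σ m φ) ψ) s).trans (cup_seq τ (coboundary σ m φ) ψ s)
  have e2 := cup_seq τ φ (coboundary τ n ψ) s
  refine Eq.trans ?_ (congrArg₂ (· + (-1 : k) ^ m • ·) e1 e2).symm
  rw [coboundary_seq, coboundary_seq, coboundary_seq τ n ψ (fun i => s (m + i)), cup_seq,
    cup_seq τ φ ψ (fun i => s (i + 1))]
  rw [Fin.sum_univ_add]
  have h1 : ∀ j : Fin m, cup τ φ ψ (fun i => contractSeq ((Fin.castAdd n j : Fin (m+n)) : ℕ) s i) =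
      τ (φ fun i => contractSeq j s i) * ψ (fun i => s (m + 1 + i)) := by
    intro j
    rw [cup_seq]
    congr 2
    ext i
    simp only [contractSeq, Fin.val_castAdd]
    rw [if_neg (by omega), if_neg (by omega)]
    congr 1; omega
  have h2 : ∀ j : Fin n, cup τ φ ψ (fun i => contractSeq ((Fin.natAdd m j : Fin (m+n)) : ℕ) s i) =
      τ (φ fun i => s i) * ψ (fun i => contractSeq j (fun i => s (m + i)) i) := by
    intro j
    rw [cup_seq]
    congr 2
    · congr 1
      ext i
      simp only [contractSeq, Fin.val_natAdd]
      rw [if_pos (by omega)]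
    · ext i
      simp only [contractSeq, Fin.val_natAdd, add_lt_add_iff_left, add_right_inj, add_assoc]
  simp only [h1, h2]
  simp only [map_add, map_sum, map_smul, map_mul, add_mul, mul_add, Finset.sum_mul,
    Finset.mul_sum, Finset.smul_sum, smul_add, smul_mul_assoc, mul_smul_comm, smul_smul,
    AlgEquiv.mul_apply, mul_assoc, Fin.val_castAdd, Fin.val_natAdd, ← pow_add, add_zero]
  have h3 : ∀ i : ℕ, s (m + i + 1) = s (m + (i + 1)) := fun i => rfl
  have h4 : ∀ i : ℕ, s (m + 1 + i) = s (m + (i + 1)) := fun i => by congr 1; omega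
  have h5 : ∀ i : ℕ, s (i + 1 + m) = s (m + (i + 1)) := fun i => by congr 1; omega
  simp only [h4, h3]
  have h6 : (-1 : k) ^ (m + 1) = - (-1) ^ m := by ring
  simp only [h6, neg_smul]
  abel

/-- The scalar `c`, as a 0-cocycle with coefficients in `A`. -/
def scalarCocycle : k →ₗ[k] cocycles (1 : A ≃ₐ[k] A) 0 where
  toFun c := ⟨MultilinearMap.constOfIsEmpty k _ (algebraMap k A c), by
    rw [LinearMap.mem_ker]
    ext a
    simp [coboundary_apply, Algebra.commutes]⟩
  map_add' c d := by ext a; simp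
  map_smul' c d := by ext a; simp [Algebra.smul_def]

theorem cup_scalar_left (τ : A ≃ₐ[k] A) {n : ℕ} (c : k) (ψ : Cochain k A n) :
    castCochain (zero_add n) (cup τ (scalarCocycle c).1 ψ) = c • ψ := by
  refine cochain_ext fun s => ?_
  rw [castCochain_seq, cup_seq]
  simp [scalarCocycle, Algebra.smul_def]

theorem cup_scalar_right {n : ℕ} (c : k) (ψ : Cochain k A n) :
    cup 1 ψ (scalarCocycle c).1 = c • ψ := by
  refine cochain_ext fun s => ?_
  erw [cup_seq]
  simp [scalarCocycle, Algebra.smul_def, Algebra.commutes]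

theorem cup_assoc (τ ρ : A ≃ₐ[k] A) {l m n : ℕ} (φ : Cochain k A l) (ψ : Cochain k A m)
    (χ : Cochain k A n) :
    castCochain (add_assoc l m n) (cup ρ (cup τ φ ψ) χ) = cup (ρ * τ) φ (cup ρ ψ χ) := by
  refine cochain_ext fun s => ?_
  rw [castCochain_seq, cup_seq, cup_seq, cup_seq, cup_seq ρ ψ χ (fun i => s (l + i))]
  simp [mul_assoc, add_assoc]

theorem coboundary_mem_coboundaries (σ : A ≃ₐ[k] A) {m n : ℕ} (h : m + 1 = n)
    (η : Cochain k A m) : castCochain h (coboundary σ m η) ∈ coboundaries σ n := by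
  subst h
  exact ⟨η, rfl⟩

theorem cup_mem_cocycles (σ τ : A ≃ₐ[k] A) {m n : ℕ} {φ : Cochain k A m} {ψ : Cochain k A n}
    (hφ : φ ∈ cocycles σ m) (hψ : ψ ∈ cocycles τ n) :
    cup τ φ ψ ∈ cocycles (τ * σ) (m + n) := by
  rw [LinearMap.mem_ker] at *
  rw [coboundary_cup, hφ, hψ]
  refine cochain_ext fun s => ?_
  rw [add_apply, smul_apply]
  erw [castCochain_seq, cup_seq, cup_seq]
  simp

theorem cup_mem_coboundaries_left (σ τ : A ≃ₐ[k] A) {m n : ℕ} {φ : Cochain k A m}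
    {ψ : Cochain k A n} (hφ : φ ∈ coboundaries σ m) (hψ : ψ ∈ cocycles τ n) :
    cup τ φ ψ ∈ coboundaries (τ * σ) (m + n) := by
  cases m with
  | zero =>
    obtain rfl : φ = 0 := hφ
    convert Submodule.zero_mem _
    ext a
    simp [cup_apply]
  | succ m =>
    obtain ⟨η, rfl⟩ := hφ
    convert coboundary_mem_coboundaries (τ * σ) (show m + n + 1 = m + 1 + n by omega)
      (cup τ η ψ)
    rw [coboundary_cup, LinearMap.mem_ker.1 hψ]
    ext a
    simp [castCochain, cup_apply]
    rfl

theorem cup_mem_coboundaries_right (σ τ : A ≃ₐ[k] A) {m n : ℕ} {φ : Cochain k A m}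
    {ψ : Cochain k A n} (hφ : φ ∈ cocycles σ m) (hψ : ψ ∈ coboundaries τ n) :
    cup τ φ ψ ∈ coboundaries (τ * σ) (m + n) := by
  cases n with
  | zero =>
    obtain rfl : ψ = 0 := hψ
    convert Submodule.zero_mem _
    ext a
    exact (cup_apply τ φ 0 a).trans (mul_zero _)
  | succ n =>
    obtain ⟨η, rfl⟩ := hψ
    refine ⟨(-1 : k) ^ m • cup τ φ η, ?_⟩
    rw [map_smul]
    erw [coboundary_cup]
    rw [LinearMap.mem_ker.1 hφ, smul_add, smul_smul, ← mul_pow]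
    ext a
    simp [castCochain, cup_apply]

/-- The class of `φ ⌣ ψ` for cocycles `φ`, `ψ`. -/
def cupCocycles (σ τ : A ≃ₐ[k] A) (m n : ℕ) :
    cocycles σ m →ₗ[k] cocycles τ n →ₗ[k] HH (τ * σ) (m + n) :=
  LinearMap.mk₂ k (fun φ ψ => HH.mk _ _ ⟨cup τ φ.1 ψ.1, cup_mem_cocycles σ τ φ.2 ψ.2⟩)
    (fun φ φ' ψ => by
      rw [← map_add]; congr 1; ext a; simp [cup_apply, add_mul])
    (fun c φ ψ => by
      rw [← map_smul]; congr 1; ext a; simp [cup_apply])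
    (fun φ ψ ψ' => by
      rw [← map_add]; congr 1; ext a; simp [cup_apply, mul_add])
    (fun c φ ψ => by
      rw [← map_smul]; congr 1; ext a; simp [cup_apply])

/-- The cup product `H^m(A, _σ A) ⊗ H^n(A, _τ A) → H^{m+n}(A, _{τ ∘ σ} A)`. -/
def HH.cup (σ τ : A ≃ₐ[k] A) (m n : ℕ) :
    HH σ m →ₗ[k] HH τ n →ₗ[k] HH (τ * σ) (m + n) :=
  HH.lift σ m
    { toFun := fun φ => HH.lift τ n (cupCocycles σ τ m n φ) fun ψ hψ =>
        (HH.mk_eq_zero _ _ _).2 (cup_mem_coboundaries_right σ τ φ.2 hψ)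
      map_add' := fun φ φ' => HH.hom_ext fun ψ => by
        simp only [HH.lift_mk, map_add, LinearMap.add_apply]
        rfl
      map_smul' := fun c φ => HH.hom_ext fun ψ => by
        simp only [HH.lift_mk, map_smul, LinearMap.smul_apply, RingHom.id_apply]
        rfl }
    fun _ hφ => HH.hom_ext fun ψ =>
      (HH.mk_eq_zero _ _ _).2 (cup_mem_coboundaries_left σ τ hφ ψ.2)

theorem HH.cup_mk (σ τ : A ≃ₐ[k] A) (m n : ℕ) (φ : cocycles σ m) (ψ : cocycles τ n) :
    HH.cup σ τ m n (HH.mk σ m φ) (HH.mk τ n ψ) =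
      HH.mk (τ * σ) (m + n) ⟨TwistedHochschild.cup τ φ.1 ψ.1, cup_mem_cocycles σ τ φ.2 ψ.2⟩ :=
  rfl

end Complex

section Ring

variable (k : Type*) [Field k] (A : Type*) [Ring A] [Algebra k A]

/-- The degrees `(n, σ)`, with `σ` an automorphism of `A`; they are added by
`(m, σ) + (n, τ) = (m + n, τ ∘ σ)`. -/
abbrev Degree : Type _ := ℕ × Additive (A ≃ₐ[k] A)ᵐᵒᵖ

variable {k A}

/-- The degree `(n, σ)`. -/
abbrev deg (n : ℕ) (σ : A ≃ₐ[k] A) : Degree k A := (n, Additive.ofMul (MulOpposite.op σ))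

/-- The automorphism `σ` of a degree `(n, σ)`. -/
abbrev Degree.twist (p : Degree k A) : A ≃ₐ[k] A := p.2.toMul.unop

noncomputable instance : DecidableEq (Degree k A) := Classical.decEq _

variable (k A)

/-- The component `H^n(A, _σ A)` of degree `(n, σ)`. -/
abbrev Component (p : Degree k A) : Type _ := HH p.twist p.1

variable {k A}

theorem gradedMk_eq {p q : Degree k A} (h₁ : p.1 = q.1) (h₂ : p.twist = q.twist)
    (φ : cocycles p.twist p.1) (ψ : cocycles q.twist q.1)
    (h : castCochain h₁ φ.1 = ψ.1) :
    GradedMonoid.mk (A := Component k A) p (HH.mk _ _ φ) =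
      GradedMonoid.mk (A := Component k A) q (HH.mk _ _ ψ) := by
  have h₃ : p.2 = q.2 := congrArg (fun σ => Additive.ofMul (MulOpposite.op σ)) h₂
  obtain ⟨m, σ⟩ := p
  obtain ⟨n, τ⟩ := q
  obtain rfl : m = n := h₁
  obtain rfl : σ = τ := h₃
  obtain rfl : φ = ψ := Subtype.ext h
  rfl

instance : GradedMonoid.GOne (Component k A) where
  one := HH.mk 1 0 (scalarCocycle 1)

instance : GradedMonoid.GMul (Component k A) where
  mul {p q} x y := HH.cup p.twist q.twist p.1 q.1 x y

instance : GradedMonoid.GMonoid (Component k A) where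
  one_mul := by
    rintro ⟨p, x⟩
    obtain ⟨φ, rfl⟩ := HH.mk_surjective _ _ x
    exact gradedMk_eq (p := 0 + p) (q := p) (zero_add _) (mul_one _) _ φ
      ((cup_scalar_left p.twist 1 φ.1).trans (one_smul k _))
  mul_one := by
    rintro ⟨p, x⟩
    obtain ⟨φ, rfl⟩ := HH.mk_surjective _ _ x
    exact gradedMk_eq (p := p + 0) (q := p) (add_zero _) (one_mul _) _ φ
      ((cup_scalar_right 1 φ.1).trans (one_smul k _))
  mul_assoc := by
    rintro ⟨p, x⟩ ⟨q, y⟩ ⟨r, z⟩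
    obtain ⟨φ, rfl⟩ := HH.mk_surjective _ _ x
    obtain ⟨ψ, rfl⟩ := HH.mk_surjective _ _ y
    obtain ⟨χ, rfl⟩ := HH.mk_surjective _ _ z
    exact gradedMk_eq (p := p + q + r) (q := p + (q + r)) (add_assoc _ _ _)
      (mul_assoc _ _ _).symm _ _ (cup_assoc q.twist r.twist φ.1 ψ.1 χ.1)

instance : DirectSum.GRing (Component k A) where
  mul_zero x := map_zero _
  zero_mul y := by
    change HH.cup _ _ _ _ 0 y = 0
    simp
  mul_add x y z := map_add _ _ _
  add_mul x y z := by
    change HH.cup _ _ _ _ (x + y) z = HH.cup _ _ _ _ x z + HH.cup _ _ _ _ y z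
    simp
  natCast n := HH.mk 1 0 (scalarCocycle n)
  natCast_zero := by rw [Nat.cast_zero, map_zero, map_zero]
  natCast_succ n := by rw [Nat.cast_succ, map_add, map_add]; rfl
  intCast n := HH.mk 1 0 (scalarCocycle n)
  intCast_ofNat n := by rw [Int.cast_natCast]
  intCast_negSucc_ofNat n := by rw [Int.cast_negSucc, map_neg, map_neg]

instance : DirectSum.GAlgebra k (Component k A) where
  toFun := ((HH.mk 1 0).comp scalarCocycle).toAddMonoidHom
  map_one := rfl
  map_mul c d := by
    refine gradedMk_eq (p := 0) (q := 0 + 0) rfl rfl _ _ ?_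
    refine Eq.trans ?_ (cup_scalar_right d (scalarCocycle (A := A) c).1).symm
    rw [mul_comm c d, ← smul_eq_mul, map_smul]
    rfl
  commutes c := by
    rintro ⟨p, x⟩
    obtain ⟨φ, rfl⟩ := HH.mk_surjective _ _ x
    exact gradedMk_eq (p := 0 + p) (q := p + 0) (zero_add _) rfl _ _
      ((cup_scalar_left p.twist c φ.1).trans (cup_scalar_right c φ.1).symm)
  smul_def c := by
    rintro ⟨p, x⟩
    obtain ⟨φ, rfl⟩ := HH.mk_surjective _ _ x
    exact (gradedMk_eq (p := 0 + p) (q := p) (zero_add _) (mul_one _) _ (c • φ)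
      (cup_scalar_left p.twist c φ.1)).symm

variable (k A)

/-- The twisted Hochschild cohomology ring `Λ_G(A) = ⨁_{n, σ} H^n(A, _σ A)`, for `G` the group of
all automorphisms of `A`, with the cup product. -/
abbrev CohomologyRing : Type _ := DirectSum (Degree k A) (Component k A)

variable {k A}

/-- The class of a cocycle in `Λ_G(A)`. -/
noncomputable def cohomologyClass (σ : A ≃ₐ[k] A) (n : ℕ) (φ : cocycles σ n) :
    CohomologyRing k A :=
  DirectSum.of (Component k A) (deg n σ) (HH.mk σ n φ)

theorem cohomologyClass_mul (σ τ : A ≃ₐ[k] A) (m n : ℕ) (φ : cocycles σ m) (ψ : cocycles τ n) :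
    cohomologyClass σ m φ * cohomologyClass τ n ψ =
      cohomologyClass (τ * σ) (m + n) ⟨cup τ φ.1 ψ.1, cup_mem_cocycles σ τ φ.2 ψ.2⟩ :=
  DirectSum.of_mul_of _ _

end Ring
end TwistedHochschild

noncomputable section

namespace Podles

open TwistedHochschild

/-- The defining relations of the standard Podleś sphere, between the free generators indexed by
`-1`, `0`, `1`. -/
inductive Rel (q : ℂˣ) : FreeAlgebra ℂ SignType → FreeAlgebra ℂ SignType → Prop
  | comm (s : SignType) (hs : s ≠ 0) :
      Rel q (FreeAlgebra.ι ℂ s * FreeAlgebra.ι ℂ 0)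
        ((q : ℂ) ^ (-2 * (s : ℤ)) • (FreeAlgebra.ι ℂ 0 * FreeAlgebra.ι ℂ s))
  | sphere (s : SignType) (hs : s ≠ 0) :
      Rel q (FreeAlgebra.ι ℂ s * FreeAlgebra.ι ℂ (-s))
        ((q : ℂ) ^ (-2 * (s : ℤ)) • FreeAlgebra.ι ℂ 0 ^ 2
          + (q : ℂ) ^ (-(s : ℤ)) • FreeAlgebra.ι ℂ 0)

/-- The standard Podleś quantum sphere `ℂ_q[S²]`: the universal unital associative `ℂ`-algebra
with generators `x_{-1}, x_0, x_1` and relations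
`x_{±1} x_0 = q^{∓2} x_0 x_{±1}`, `x_{±1} x_{∓1} = q^{∓2} x_0² + q^{∓1} x_0`. -/
def Sphere (q : ℂˣ) : Type := RingQuot (Rel q)

instance (q : ℂˣ) : Ring (Sphere q) := inferInstanceAs (Ring (RingQuot (Rel q)))

instance (q : ℂˣ) : Algebra ℂ (Sphere q) := inferInstanceAs (Algebra ℂ (RingQuot (Rel q)))

/-- The projection of the free algebra onto `ℂ_q[S²]`. -/
def mk (q : ℂˣ) : FreeAlgebra ℂ SignType →ₐ[ℂ] Sphere q := RingQuot.mkAlgHom ℂ (Rel q)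

theorem mk_surjective (q : ℂˣ) : Function.Surjective (mk q) :=
  RingQuot.mkAlgHom_surjective ℂ (Rel q)

theorem mk_rel (q : ℂˣ) {a b : FreeAlgebra ℂ SignType} (h : Rel q a b) : mk q a = mk q b :=
  RingQuot.mkAlgHom_rel ℂ h

/-- The generators `x_{-1}, x_0, x_1`. -/
def x (q : ℂˣ) (i : SignType) : Sphere q := mk q (FreeAlgebra.ι ℂ i)

theorem x_comm (q : ℂˣ) (s : SignType) (hs : s ≠ 0) :
    x q s * x q 0 = (q : ℂ) ^ (-2 * (s : ℤ)) • (x q 0 * x q s) := by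
  simpa [x] using mk_rel q (Rel.comm s hs)

theorem x_sphere (q : ℂˣ) (s : SignType) (hs : s ≠ 0) :
    x q s * x q (-s) = (q : ℂ) ^ (-2 * (s : ℤ)) • x q 0 ^ 2 + (q : ℂ) ^ (-(s : ℤ)) • x q 0 := by
  simpa [x] using mk_rel q (Rel.sphere s hs)

/-- The universal property of `ℂ_q[S²]`. -/
def lift (q : ℂˣ) {B : Type*} [Ring B] [Algebra ℂ B] (y : SignType → B)
    (h₁ : ∀ s : SignType, s ≠ 0 → y s * y 0 = (q : ℂ) ^ (-2 * (s : ℤ)) • (y 0 * y s))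
    (h₂ : ∀ s : SignType, s ≠ 0 → y s * y (-s) =
      (q : ℂ) ^ (-2 * (s : ℤ)) • y 0 ^ 2 + (q : ℂ) ^ (-(s : ℤ)) • y 0) :
    Sphere q →ₐ[ℂ] B :=
  RingQuot.liftAlgHom ℂ ⟨FreeAlgebra.lift ℂ y, by
    rintro _ _ (⟨s, hs⟩ | ⟨s, hs⟩)
    · simpa using h₁ s hs
    · simpa using h₂ s hs⟩

theorem lift_x (q : ℂˣ) {B : Type*} [Ring B] [Algebra ℂ B] (y : SignType → B)
    (h₁ : ∀ s : SignType, s ≠ 0 → y s * y 0 = (q : ℂ) ^ (-2 * (s : ℤ)) • (y 0 * y s))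
    (h₂ : ∀ s : SignType, s ≠ 0 → y s * y (-s) =
      (q : ℂ) ^ (-2 * (s : ℤ)) • y 0 ^ 2 + (q : ℂ) ^ (-(s : ℤ)) • y 0) (i : SignType) :
    lift q y h₁ h₂ (x q i) = y i :=
  (RingQuot.liftAlgHom_mkAlgHom_apply ℂ _ _ _).trans (FreeAlgebra.lift_ι_apply _ _)

theorem hom_ext {q : ℂˣ} {B : Type*} [Ring B] [Algebra ℂ B] {f g : Sphere q →ₐ[ℂ] B}
    (h : ∀ i, f (x q i) = g (x q i)) : f = g := by
  have : f.comp (mk q) = g.comp (mk q) := FreeAlgebra.hom_ext (funext h)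
  ext a
  obtain ⟨b, rfl⟩ := mk_surjective q a
  exact DFunLike.congr_fun this b

/-- The endomorphism `x_n ↦ λ^n x_n`. -/
def scaleHom (q l : ℂˣ) : Sphere q →ₐ[ℂ] Sphere q :=
  lift q (fun i => (l : ℂ) ^ (i : ℤ) • x q i)
    (fun s hs => by
      simp [x_comm q s hs, smul_smul, mul_comm])
    (fun s hs => by
      have hl : (l : ℂ) ^ (s : ℤ) ≠ 0 := zpow_ne_zero _ l.ne_zero
      simp only [SignType.coe_neg, zpow_neg, smul_mul_smul_comm, mul_inv_cancel₀ hl, one_smul,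
        x_sphere q s hs, SignType.coe_zero, zpow_zero])

theorem scaleHom_x (q l : ℂˣ) (i : SignType) :
    scaleHom q l (x q i) = (l : ℂ) ^ (i : ℤ) • x q i :=
  lift_x _ _ _ _ _

/-- The automorphism `σ_λ` of `ℂ_q[S²]` with `σ_λ(x_n) = λ^n x_n`. -/
def scale (q l : ℂˣ) : Sphere q ≃ₐ[ℂ] Sphere q :=
  AlgEquiv.ofAlgHom (scaleHom q l) (scaleHom q l⁻¹)
    (hom_ext fun i => by
      have hl : (l : ℂ) ^ (i : ℤ) ≠ 0 := zpow_ne_zero _ l.ne_zero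
      simp [scaleHom_x, smul_smul, hl])
    (hom_ext fun i => by
      have hl : (l : ℂ) ^ (i : ℤ) ≠ 0 := zpow_ne_zero _ l.ne_zero
      simp [scaleHom_x, smul_smul, hl])

theorem scale_x (q l : ℂˣ) (i : SignType) : scale q l (x q i) = (l : ℂ) ^ (i : ℤ) • x q i :=
  scaleHom_x q l i

/-- Woronowicz's modular automorphism `σ_mod(x_n) = q^{2n} x_n`. -/
def sigmaMod (q : ℂˣ) : Sphere q ≃ₐ[ℂ] Sphere q := scale q (q ^ 2)

/-- The automorphism `σ_mod^{-|i|}` by which `∂_i` is twisted. -/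
def twist (q : ℂˣ) (i : SignType) : Sphere q ≃ₐ[ℂ] Sphere q := sigmaMod q ^ (-|(i : ℤ)|)

theorem twist_zero (q : ℂˣ) : twist q 0 = 1 := by simp [twist]

theorem twist_x (q : ℂˣ) (i j : SignType) :
    twist q i (x q j) = (q : ℂ) ^ (-2 * |(i : ℤ)| * (j : ℤ)) • x q j := by
  have h : ∀ j, (sigmaMod q)⁻¹ (x q j) = (q : ℂ) ^ (-2 * (j : ℤ)) • x q j := by
    intro j
    rw [AlgEquiv.aut_inv, AlgEquiv.symm_apply_eq, map_smul, sigmaMod, scale_x, smul_smul]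
    rw [Units.val_pow_eq_pow_val, ← zpow_natCast, ← zpow_mul, ← zpow_add₀ q.ne_zero]
    simp
  cases i <;> simp [twist, h]

/-- The values of `∂_i` on the generators. -/
def derivValue (q : ℂˣ) : SignType → SignType → Sphere q
  | .pos, .neg => 0
  | .pos, .zero => (q : ℂ) • x q (-1)
  | .pos, .pos => 1 + ((q : ℂ) + (q : ℂ)⁻¹) • x q 0
  | .zero, .neg => - x q (-1)
  | .zero, .zero => 0
  | .zero, .pos => x q 1
  | .neg, .neg => 1 + ((q : ℂ) + (q : ℂ)⁻¹) • x q 0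
  | .neg, .zero => (q : ℂ)⁻¹ • x q 1
  | .neg, .pos => 0

theorem derivValue_pos_neg (q : ℂˣ) : derivValue q 1 (-1) = 0 := rfl

theorem derivValue_pos_zero (q : ℂˣ) : derivValue q 1 0 = (q : ℂ) • x q (-1) := rfl

theorem derivValue_pos_pos (q : ℂˣ) : derivValue q 1 1 = 1 + ((q : ℂ) + (q : ℂ)⁻¹) • x q 0 := rfl

theorem derivValue_zero_neg (q : ℂˣ) : derivValue q 0 (-1) = -x q (-1) := rfl

theorem derivValue_zero_zero (q : ℂˣ) : derivValue q 0 0 = 0 := rfl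

theorem derivValue_zero_pos (q : ℂˣ) : derivValue q 0 1 = x q 1 := rfl

theorem derivValue_neg_neg (q : ℂˣ) : derivValue q (-1) (-1) = 1 + ((q : ℂ) + (q : ℂ)⁻¹) • x q 0 := rfl

theorem derivValue_neg_zero (q : ℂˣ) : derivValue q (-1) 0 = (q : ℂ)⁻¹ • x q 1 := rfl

theorem derivValue_neg_pos (q : ℂˣ) : derivValue q (-1) 1 = 0 := rfl

theorem x_neg_zero (q : ℂˣ) : x q (-1) * x q 0 = (q : ℂ) ^ 2 • (x q 0 * x q (-1)) := by
  simpa using x_comm q (-1) (by decide)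

theorem x_pos_zero (q : ℂˣ) : x q 1 * x q 0 = ((q : ℂ) ^ 2)⁻¹ • (x q 0 * x q 1) := by
  have := x_comm q 1 (by decide)
  rw [this]
  congr 1

theorem x_pos_neg (q : ℂˣ) :
    x q 1 * x q (-1) = ((q : ℂ) ^ 2)⁻¹ • (x q 0 * x q 0) + (q : ℂ)⁻¹ • x q 0 := by
  have := x_sphere q 1 (by decide)
  rw [this, sq]
  congr 2
  simp

theorem x_neg_pos (q : ℂˣ) :
    x q (-1) * x q 1 = (q : ℂ) ^ 2 • (x q 0 * x q 0) + (q : ℂ) • x q 0 := by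
  simpa [sq (x q 0)] using x_sphere q (-1) (by decide)

theorem twist_apply_neg (q : ℂˣ) (i : SignType) (hi : i ≠ 0) :
    twist q i (x q (-1)) = (q : ℂ) ^ 2 • x q (-1) := by
  rw [twist_x]
  cases i
  · exact absurd rfl hi
  · congr 1
  · congr 1

theorem twist_apply_zero (q : ℂˣ) (i : SignType) : twist q i (x q 0) = x q 0 := by
  rw [twist_x]; simp

theorem twist_apply_pos (q : ℂˣ) (i : SignType) (hi : i ≠ 0) :
    twist q i (x q 1) = ((q : ℂ) ^ 2)⁻¹ • x q 1 := by
  rw [twist_x]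
  cases i
  · exact absurd rfl hi
  · congr 1
  · congr 1

/-- The algebra map `a ↦ !![σ(a), ∂_i(a); 0, a]`, for `σ = σ_mod^{-|i|}`; it is multiplicative
exactly because `∂_i` is a `σ`-twisted derivation. -/
def derivHom (q : ℂˣ) (i : SignType) : Sphere q →ₐ[ℂ] Matrix (Fin 2) (Fin 2) (Sphere q) :=
  lift q (fun j => !![twist q i (x q j), derivValue q i j; 0, x q j])
    (fun s hs => by
      have h := congrArg (twist q i) (x_comm q s hs)
      rw [map_mul, map_smul, map_mul] at h
      have hd : twist q i (x q s) * derivValue q i 0 + derivValue q i s * x q 0 =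
          (q : ℂ) ^ (-2 * (s : ℤ)) •
            (twist q i (x q 0) * derivValue q i s + derivValue q i 0 * x q s) := by
        have hq := q.ne_zero
        have e1 : twist q 1 (x q (-1)) = _ := twist_apply_neg q 1 (by decide)
        have e2 : twist q (-1) (x q (-1)) = _ := twist_apply_neg q (-1) (by decide)
        have e3 : twist q 1 (x q 1) = _ := twist_apply_pos q 1 (by decide)
        have e4 : twist q (-1) (x q 1) = _ := twist_apply_pos q (-1) (by decide)
        have e5 : (q : ℂ) ^ (-2 * ((1 : SignType) : ℤ)) = ((q : ℂ) ^ 2)⁻¹ := by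
          congr 1
        have e6 : (q : ℂ) ^ (-2 * ((-1 : SignType) : ℤ)) = (q : ℂ) ^ 2 := by
          simp
        obtain rfl | rfl : s = -1 ∨ s = 1 := by clear h; revert s; decide
        all_goals
          obtain rfl | rfl | rfl : i = -1 ∨ i = 0 ∨ i = 1 := by clear h; revert i; decide
        all_goals
          simp only [e1, e2, e3, e4, e5, e6, twist_zero, AlgEquiv.one_apply, twist_apply_zero,
            derivValue_neg_neg, derivValue_neg_zero, derivValue_neg_pos, derivValue_zero_neg,
            derivValue_zero_zero, derivValue_zero_pos, derivValue_pos_neg, derivValue_pos_zero,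
            derivValue_pos_pos]
          simp only [mul_zero, zero_mul, add_zero, zero_add, mul_add, add_mul, mul_one,
            one_mul, smul_mul_assoc, mul_smul_comm, smul_smul, smul_add, mul_neg, neg_mul,
            smul_neg, x_neg_zero, x_pos_zero, x_pos_neg, x_neg_pos]
        all_goals
          try match_scalars
        all_goals
          try field_simp
        all_goals
          try ring
      simp [Matrix.smul_of, h, hd, x_comm q s hs])
    (fun s hs => by
      have h := congrArg (twist q i) (x_sphere q s hs)
      rw [map_mul, map_add, map_smul, map_smul, map_pow] at h
      have hd : twist q i (x q s) * derivValue q i (-s) + derivValue q i s * x q (-s) =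
          (q : ℂ) ^ (-2 * (s : ℤ)) •
            (twist q i (x q 0) * derivValue q i 0 + derivValue q i 0 * x q 0)
          + (q : ℂ) ^ (-(s : ℤ)) • derivValue q i 0 := by
        have hq := q.ne_zero
        have e1 : twist q 1 (x q (-1)) = _ := twist_apply_neg q 1 (by decide)
        have e2 : twist q (-1) (x q (-1)) = _ := twist_apply_neg q (-1) (by decide)
        have e3 : twist q 1 (x q 1) = _ := twist_apply_pos q 1 (by decide)
        have e4 : twist q (-1) (x q 1) = _ := twist_apply_pos q (-1) (by decide)
        have e5 : (q : ℂ) ^ (-2 * ((1 : SignType) : ℤ)) = ((q : ℂ) ^ 2)⁻¹ := by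
          congr 1
        have e6 : (q : ℂ) ^ (-2 * ((-1 : SignType) : ℤ)) = (q : ℂ) ^ 2 := by
          simp
        have e7 : (q : ℂ) ^ (-((1 : SignType) : ℤ)) = (q : ℂ)⁻¹ := by simp
        have e8 : (q : ℂ) ^ (-((-1 : SignType) : ℤ)) = (q : ℂ) := by simp
        obtain rfl | rfl : s = -1 ∨ s = 1 := by clear h; revert s; decide
        all_goals
          obtain rfl | rfl | rfl : i = -1 ∨ i = 0 ∨ i = 1 := by clear h; revert i; decide
        all_goals
          simp only [neg_neg, e1, e2, e3, e4, e5, e6, e7, e8, twist_zero, AlgEquiv.one_apply, twist_apply_zero,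
            derivValue_neg_neg, derivValue_neg_zero, derivValue_neg_pos, derivValue_zero_neg,
            derivValue_zero_zero, derivValue_zero_pos, derivValue_pos_neg, derivValue_pos_zero,
            derivValue_pos_pos]
          simp only [mul_zero, zero_mul, add_zero, zero_add, smul_zero, mul_add, add_mul, mul_one,
            one_mul, smul_mul_assoc, mul_smul_comm, smul_smul, smul_add, mul_neg, neg_mul,
            x_neg_zero, x_pos_zero, x_pos_neg, x_neg_pos]
        all_goals
          try match_scalars
        all_goals
          try field_simp
        all_goals
          try ring
      simp [pow_two, Matrix.smul_of, h, hd, x_sphere q s hs])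

theorem derivHom_x (q : ℂˣ) (i j : SignType) :
    derivHom q i (x q j) = !![twist q i (x q j), derivValue q i j; 0, x q j] :=
  lift_x _ _ _ _ _

theorem sphere_induction {q : ℂˣ} {P : Sphere q → Prop} (hc : ∀ c : ℂ, P (algebraMap ℂ _ c))
    (hx : ∀ i, P (x q i)) (hadd : ∀ a b, P a → P b → P (a + b))
    (hmul : ∀ a b, P a → P b → P (a * b)) (a : Sphere q) : P a := by
  obtain ⟨b, rfl⟩ := mk_surjective q a
  induction b using FreeAlgebra.induction with
  | grade0 c => rw [AlgHom.commutes]; exact hc c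
  | grade1 i => exact hx i
  | mul a b ha hb => rw [map_mul]; exact hmul _ _ ha hb
  | add a b ha hb => rw [map_add]; exact hadd _ _ ha hb

theorem derivHom_entries (q : ℂˣ) (i : SignType) (a : Sphere q) :
    derivHom q i a 0 0 = twist q i a ∧ derivHom q i a 1 0 = 0 ∧ derivHom q i a 1 1 = a := by
  induction a using sphere_induction with
  | hc c => simp [Matrix.algebraMap_matrix_apply]
  | hx j => simp [derivHom_x]
  | hadd a b ha hb => simp [ha, hb]
  | hmul a b ha hb => simp [Matrix.mul_apply, Fin.sum_univ_two, ha, hb]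

/-- The twisted derivations `∂_{-1}, ∂_0, ∂_1` of `ℂ_q[S²]`. -/
def deriv (q : ℂˣ) (i : SignType) : Sphere q →ₗ[ℂ] Sphere q where
  toFun a := derivHom q i a 0 1
  map_add' a b := by simp
  map_smul' c a := by simp

theorem deriv_x (q : ℂˣ) (i j : SignType) : deriv q i (x q j) = derivValue q i j := by
  simp [deriv, derivHom_x]

theorem deriv_mul (q : ℂˣ) (i : SignType) (a b : Sphere q) :
    deriv q i (a * b) = twist q i a * deriv q i b + deriv q i a * b := by
  simp [deriv, Matrix.mul_apply, Fin.sum_univ_two, derivHom_entries]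

/-- `∂_i`, as a 1-cocycle with coefficients in `_σ A`, `σ = σ_mod^{-|i|}`. -/
def derivCocycle (q : ℂˣ) (i : SignType) : cocycles (twist q i) 1 :=
  ⟨MultilinearMap.ofSubsingleton ℂ (Sphere q) (Sphere q) (0 : Fin 1) (deriv q i), by
    rw [LinearMap.mem_ker]
    ext a
    simp [coboundary_apply, Fin.contractNth, Fin.tail, Fin.init, deriv_mul]⟩

/-- The class `[∂_i]` in the twisted Hochschild cohomology ring of `ℂ_q[S²]`. -/
def derivClass (q : ℂˣ) (i : SignType) : CohomologyRing ℂ (Sphere q) :=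
  cohomologyClass (twist q i) 1 (derivCocycle q i)

end Podles

end

noncomputable section

namespace Podles

open TwistedHochschild Polynomial


/-! The quadratic relations hold because composites of twisted derivations are homotopies. The
derivation `∂_i` lowers the weight by `i`, so it commutes with the twists up to a power of `q`. The
coboundary of `∂_i ∘ ∂_j` therefore consists, up to sign, of the two cross terms of the Leibniz
rule, which are multiples of `∂_i ⌣ ∂_j` and `∂_j ⌣ ∂_i` (`coboundary_derivComp`). The squares
vanish since `1 + 1` and `1 + q^{±2}` are nonzero.

For independence in degree 2, a 2-cochain is summed over the purely quadratic relation `x_{-1} x_1 -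
q² x_1 x_{-1} + (1 - q²) x_0² = 0` and a functional is applied. The terms `η(ab)` of a coboundary
cancel by the relation, and the remaining ones are killed by the counit or, for the twist
`σ_mod^{-1}`, by `ε ∘ ∂_{±1}`. These functionals separate the three ordered products
(`derivClass_mul_linearIndependent`).

The cubic product is the hard point. A 3-cocycle `ψ(a, b) D(c)` with `D` an ordinary derivation is
viewed as a 2-cocycle in `a, b` with values in maps of `c`, hence as a square-zero extension of `A`.
An algebra splitting of that extension provides a primitive (`exists_primitive`). Since `A` is given
by generators and relations, a splitting is a choice of lifts of three generators satisfying four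
relations. The lifts are built from `∂_0` and two truncated division operators `lower` and `raise`,
obtained from a concrete model of `A` as a sum of copies of `ℂ[x_0]` indexed by the weight.

These facts determine the kernel: the relations reduce every word to seven ordered monomials, and
multiplication into degree 2 shows that the images of the seven are independent
(`ker_lift_eq_span`). -/

/-! ### The quadratic relations between the classes. -/

theorem cohomologyClass_congr {k A : Type*} [Field k] [Ring A] [Algebra k A] {σ τ : A ≃ₐ[k] A}
    (h : σ = τ) {n : ℕ} (φ : cocycles σ n) (ψ : cocycles τ n) (hφ : φ.1 = ψ.1) :
    cohomologyClass σ n φ = cohomologyClass τ n ψ := by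
  subst h
  rw [Subtype.ext hφ]

theorem cohomologyClass_add {k A : Type*} [Field k] [Ring A] [Algebra k A] {σ : A ≃ₐ[k] A}
    {n : ℕ} (φ ψ : cocycles σ n) :
    cohomologyClass σ n (φ + ψ) = cohomologyClass σ n φ + cohomologyClass σ n ψ := by
  simp [cohomologyClass]

theorem cohomologyClass_smul {k A : Type*} [Field k] [Ring A] [Algebra k A] {σ : A ≃ₐ[k] A}
    {n : ℕ} (c : k) (φ : cocycles σ n) :
    cohomologyClass σ n (c • φ) = c • cohomologyClass σ n φ := by
  have := (DirectSum.lof k (Degree k A) (Component k A) (deg n σ)).map_smul c (HH.mk σ n φ)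
  rw [← map_smul] at this
  exact this

theorem cohomologyClass_eq_zero_iff {k A : Type*} [Field k] [Ring A] [Algebra k A]
    {σ : A ≃ₐ[k] A} {n : ℕ} (φ : cocycles σ n) :
    cohomologyClass σ n φ = 0 ↔ φ.1 ∈ coboundaries σ n := by
  rw [← HH.mk_eq_zero]
  exact (DirectSum.of_injective (β := Component k A) (deg n σ)).eq_iff' (map_zero _)

theorem twist_comm (q : ℂˣ) (i j : SignType) : twist q i * twist q j = twist q j * twist q i := by
  simp only [twist, ← zpow_add, add_comm]

theorem twist_twist_comm (q : ℂˣ) (i j : SignType) (a : Sphere q) :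
    twist q i (twist q j a) = twist q j (twist q i a) :=
  DFunLike.congr_fun (twist_comm q i j) a

theorem deriv_one (q : ℂˣ) (i : SignType) : deriv q i 1 = 0 := by
  have := deriv_mul q i 1 1
  simpa using this

theorem deriv_algebraMap (q : ℂˣ) (i : SignType) (c : ℂ) :
    deriv q i (algebraMap ℂ _ c) = 0 := by
  rw [Algebra.algebraMap_eq_smul_one, map_smul, deriv_one, smul_zero]

/-- The twist by `j` acts on weight `w` as `q^{-2|j|w}`, and `∂_i` lowers the weight by `i`. Both
sides satisfy the same Leibniz rule, so the generators suffice. -/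
theorem deriv_twist (q : ℂˣ) (i j : SignType) (a : Sphere q) :
    deriv q i (twist q j a) =
      (q : ℂ) ^ (-2 * |(j : ℤ)| * (i : ℤ)) • twist q j (deriv q i a) := by
  have hq := q.ne_zero
  induction a using sphere_induction with
  | hc c => simp [deriv_algebraMap]
  | hx k =>
    rw [twist_x, map_smul, deriv_x]
    cases i <;> cases j <;> cases k <;>
      simp [derivValue, twist_x, smul_smul, twist_zero]
    all_goals congr 1; field_simp
  | hadd a b ha hb => simp [ha, hb]
  | hmul a b ha hb =>
    rw [map_mul, deriv_mul, ha, hb, deriv_mul, map_add, map_mul, map_mul, twist_twist_comm q i j,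
      smul_add, mul_smul_comm, smul_mul_assoc]


/-- The composite `∂_i ∘ ∂_j`, as a 1-cochain. -/
def derivComp (q : ℂˣ) (i j : SignType) : Cochain ℂ (Sphere q) 1 :=
  MultilinearMap.ofSubsingleton ℂ (Sphere q) (Sphere q) (0 : Fin 1) (deriv q i ∘ₗ deriv q j)

/-- Expanding `∂_i(∂_j(ab))` by the Leibniz rule twice gives four terms. The two outer ones cancel
against the outer terms of the coboundary, and the mixed ones are the cup products, one of them
after moving `∂_i` past the twist. -/
theorem coboundary_derivComp (q : ℂˣ) (i j : SignType) :
    coboundary (twist q j * twist q i) 1 (derivComp q i j) =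
      -((q : ℂ) ^ (-2 * |(j : ℤ)| * (i : ℤ)) • cup (twist q j) (derivCocycle q i).1 (derivCocycle q j).1
        + cup (twist q i) (derivCocycle q j).1 (derivCocycle q i).1) := by
  ext a
  rw [coboundary_apply]
  change _ = -((q : ℂ) ^ (-2 * |(j : ℤ)| * (i : ℤ)) • cup (twist q j) (derivCocycle q i).1 (derivCocycle q j).1 a +
    cup (twist q i) (derivCocycle q j).1 (derivCocycle q i).1 a)
  rw [cup_apply, cup_apply]
  simp [derivComp, derivCocycle, Fin.contractNth, Fin.tail, Fin.init, deriv_mul, deriv_twist]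
  rw [twist_twist_comm q i j]
  abel

theorem derivClass_mul (q : ℂˣ) (i j : SignType) :
    derivClass q i * derivClass q j =
      -((q : ℂ) ^ (2 * |(j : ℤ)| * (i : ℤ)) • (derivClass q j * derivClass q i)) := by
  have hq := q.ne_zero
  rw [derivClass, derivClass, cohomologyClass_mul, cohomologyClass_mul]
  rw [cohomologyClass_congr (twist_comm q i j)
    ⟨cup (twist q i) (derivCocycle q j).1 (derivCocycle q i).1, cup_mem_cocycles _ _ (derivCocycle q j).2 (derivCocycle q i).2⟩
    ⟨cup (twist q i) (derivCocycle q j).1 (derivCocycle q i).1, twist_comm q i j ▸ cup_mem_cocycles _ _ (derivCocycle q j).2 (derivCocycle q i).2⟩ rfl]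
  rw [← cohomologyClass_smul, ← add_eq_zero_iff_eq_neg, ← cohomologyClass_add, cohomologyClass_eq_zero_iff]
  refine ⟨-((q : ℂ) ^ (2 * |(j : ℤ)| * (i : ℤ)) • derivComp q i j), ?_⟩
  rw [map_neg, map_smul, coboundary_derivComp, smul_neg, neg_neg, smul_add, smul_smul, ← zpow_add₀ hq]
  simp

theorem derivClass_mul_self (q : ℂˣ) (hq : (q : ℂ) ^ 4 ≠ 1) (i : SignType) :
    derivClass q i * derivClass q i = 0 := by
  have h := eq_neg_iff_add_eq_zero.1 (derivClass_mul q i i)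
  have h1 : derivClass q i * derivClass q i +
      (q : ℂ) ^ (2 * |(i : ℤ)| * (i : ℤ)) • (derivClass q i * derivClass q i) =
      (1 + (q : ℂ) ^ (2 * |(i : ℤ)| * (i : ℤ))) • (derivClass q i * derivClass q i) := by
    rw [add_smul, one_smul]
  rw [h1] at h
  refine (smul_eq_zero.1 h).resolve_left fun h0 => ?_
  rcases i with _ | _ | _
  · simp at h0
  · simp at h0
    have : (q : ℂ) ^ 2 = -1 := by
      have h2 : (q : ℂ) ^ 2 ≠ 0 := pow_ne_zero _ q.ne_zero
      field_simp at h0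
      linear_combination h0
    -- `(q² - 1)(q² + 1) = q⁴ - 1`.
    exact hq (by linear_combination ((q : ℂ) ^ 2 - 1) * this)
  · simp at h0
    have h2 : (q : ℂ) ^ 2 = -1 := by 
      have : (1 : ℂ) + (q : ℂ) ^ 2 = 0 := h0
      linear_combination this
    exact hq (by linear_combination ((q : ℂ) ^ 2 - 1) * h2)

theorem derivClass_mul_of_le (q : ℂˣ) (hq : (q : ℂ) ^ 4 ≠ 1) (i j : SignType) (hij : i ≤ j) :
    derivClass q i * derivClass q j =
      -((q : ℂ) ^ (2 * (i : ℤ) * (j : ℤ)) • (derivClass q j * derivClass q i)) := by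
  rcases j with _ | _ | _
  · simpa using derivClass_mul q i 0
  -- For `j = -1` the exponents `2|j|i` and `2ij` differ, but `i ≤ j` leaves only the square, which
  -- is zero.
  · obtain rfl : i = -1 := le_antisymm hij (by revert i; decide)
    simp [derivClass_mul_self q hq]
  · simpa [mul_assoc, mul_comm] using derivClass_mul q i 1


/-! ### Linear independence of the quadratic products. -/

/-- The counit `ε : ℂ_q[S²] → ℂ`, the character vanishing on the generators. -/
def counit (q : ℂˣ) : Sphere q →ₐ[ℂ] ℂ :=
  lift q (fun _ => 0) (by simp) (by simp)

theorem counit_x (q : ℂˣ) (i : SignType) : counit q (x q i) = 0 :=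
  lift_x _ _ _ _ _

theorem counit_twist (q : ℂˣ) (i : SignType) (a : Sphere q) :
    counit q (twist q i a) = counit q a := by
  have : (counit q).comp (twist q i).toAlgHom = counit q :=
    hom_ext fun j => by simp [twist_x, counit_x]
  exact DFunLike.congr_fun this a

/-- `ε ∘ ∂_i`. -/
def tangent (q : ℂˣ) (i : SignType) : Sphere q →ₗ[ℂ] ℂ :=
  (counit q).toLinearMap ∘ₗ deriv q i

theorem tangent_apply (q : ℂˣ) (i : SignType) (a : Sphere q) :
    tangent q i a = counit q (deriv q i a) := rfl

theorem tangent_mul (q : ℂˣ) (i : SignType) (a b : Sphere q) :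
    tangent q i (a * b) = counit q a * tangent q i b + tangent q i a * counit q b := by
  simp [tangent_apply, deriv_mul, counit_twist]

theorem tangent_x_zero (q : ℂˣ) (i : SignType) : tangent q i (x q 0) = 0 := by
  rw [tangent_apply, deriv_x]
  cases i <;> simp [derivValue, counit_x]

/-- The functional `χ` evaluated on the combination of values of a 2-cochain that belongs to
`x_{-1} x_1 - q² x_1 x_{-1} + (1 - q²) x_0² = 0`. -/
def relationPairing (q : ℂˣ) (χ : Sphere q →ₗ[ℂ] ℂ) (φ : Cochain ℂ (Sphere q) 2) : ℂ :=
  χ (φ ![x q (-1), x q 1]) - (q : ℂ) ^ 2 * χ (φ ![x q 1, x q (-1)])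
    + (1 - (q : ℂ) ^ 2) * χ (φ ![x q 0, x q 0])

/-- The relation has no linear part in `x_0`, so the inner terms `η(ab)` add up to `η` of zero. -/
theorem relationPairing_coboundary (q : ℂˣ) (χ : Sphere q →ₗ[ℂ] ℂ) (σ : Sphere q ≃ₐ[ℂ] Sphere q)
    (η : Cochain ℂ (Sphere q) 1) :
    relationPairing q χ (coboundary σ 1 η) =
      χ (σ (x q (-1)) * η ![x q 1] + η ![x q (-1)] * x q 1)
        - (q : ℂ) ^ 2 * χ (σ (x q 1) * η ![x q (-1)] + η ![x q 1] * x q (-1))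
        + (1 - (q : ℂ) ^ 2) * χ (σ (x q 0) * η ![x q 0] + η ![x q 0] * x q 0) := by
  -- The inner term is written through `η.toLinearMap ![0] 0`, which is `η` as a linear map in its
  -- only argument, so that it can be expanded along the relation.
  have hb : ∀ a b : Sphere q, coboundary σ 1 η ![a, b] =
      σ a * η ![b] + η ![a] * b - (η.toLinearMap ![0] 0) (a * b) := by
    intro a b
    rw [coboundary_apply]
    have h1 : Fin.tail ![a, b] = ![b] := by ext i; fin_cases i; rfl
    have h2 : Fin.init ![a, b] = ![a] := by ext i; fin_cases i; rfl
    have h3 : Fin.contractNth (0 : Fin 2) (· * ·) ![a, b] = ![a * b] := by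
      ext i; fin_cases i; rfl
    have h4 : Function.update ![(0 : Sphere q)] 0 (a * b) = ![a * b] := by
      ext i; fin_cases i; simp
    rw [h1, h2]
    simp [h3, h4]
    abel
  have hr : x q (-1) * x q 1 =
      (q : ℂ) ^ 2 • (x q 1 * x q (-1)) - (1 - (q : ℂ) ^ 2) • (x q 0 * x q 0) := by
    have hq := q.ne_zero
    rw [x_neg_pos, x_pos_neg]
    match_scalars
    · field_simp
      ring
    · field_simp
  rw [relationPairing, hb, hb, hb, hr]
  simp only [map_sub, map_add, map_smul, smul_eq_mul]
  ring

theorem relationPairing_cup (q : ℂˣ) (χ : Sphere q →ₗ[ℂ] ℂ) (i j : SignType) :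
    relationPairing q χ (cup (twist q j) (derivCocycle q i).1 (derivCocycle q j).1) =
      χ (twist q j (derivValue q i (-1)) * derivValue q j 1)
        - (q : ℂ) ^ 2 * χ (twist q j (derivValue q i 1) * derivValue q j (-1))
        + (1 - (q : ℂ) ^ 2) * χ (twist q j (derivValue q i 0) * derivValue q j 0) := by
  have h : ∀ a b : Sphere q, cup (twist q j) (derivCocycle q i).1 (derivCocycle q j).1 ![a, b] =
      twist q j (deriv q i a) * deriv q j b := by
    intro a b
    erw [cup_apply]
    rfl
  rw [relationPairing, h, h, h]
  simp only [deriv_x]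

theorem relationPairing_add (q : ℂˣ) (χ : Sphere q →ₗ[ℂ] ℂ) (φ ψ : Cochain ℂ (Sphere q) 2) :
    relationPairing q χ (φ + ψ) = relationPairing q χ φ + relationPairing q χ ψ := by
  simp only [relationPairing, add_apply, map_add]
  ring

theorem relationPairing_smul (q : ℂˣ) (χ : Sphere q →ₗ[ℂ] ℂ) (c : ℂ) (φ : Cochain ℂ (Sphere q) 2) :
    relationPairing q χ (c • φ) = c * relationPairing q χ φ := by
  simp only [relationPairing, smul_apply, map_smul, smul_eq_mul]
  ring

theorem relationPairing_counit_coboundary (q : ℂˣ) (σ : Sphere q ≃ₐ[ℂ] Sphere q)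
    (hσ : ∀ a, counit q (σ a) = counit q a) (η : Cochain ℂ (Sphere q) 1) :
    relationPairing q (counit q).toLinearMap (coboundary σ 1 η) = 0 := by
  rw [relationPairing_coboundary]
  simp [hσ, counit_x]

/-- A tangent functional sees only `ε(η(x_j))`. The factors `q^{±2}` by which this particular twist
scales `x_{∓1}` match the coefficient `q²` of the relation, so the contributions cancel in pairs;
those of `x_0` vanish separately. -/
theorem relationPairing_tangent_coboundary (q : ℂˣ) (i : SignType) (η : Cochain ℂ (Sphere q) 1) :
    relationPairing q (tangent q i) (coboundary (twist q 1) 1 η) = 0 := by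
  have hq := q.ne_zero
  have e1 : twist q 1 (x q (-1)) = _ := twist_apply_neg q 1 (by decide)
  have e3 : twist q 1 (x q 1) = _ := twist_apply_pos q 1 (by decide)
  rw [relationPairing_coboundary, e1, e3, twist_apply_zero]
  simp [tangent_mul, counit_x, tangent_x_zero]
  field_simp
  ring

theorem counit_derivValue (q : ℂˣ) (i j : SignType) :
    counit q (derivValue q i j) = if i = j ∧ i ≠ 0 then 1 else 0 := by
  cases i <;> cases j <;> simp [derivValue, counit_x]

theorem twist_neg_one (q : ℂˣ) : twist q (-1) = twist q 1 := by
  simp [twist]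

theorem twist_one_ne_one (q : ℂˣ) (hq : (q : ℂ) ^ 2 ≠ 1) : twist q 1 ≠ 1 := by
  intro h
  have h1 : twist q 1 (x q 1) = x q 1 := by rw [h]; rfl
  have e3 : twist q 1 (x q 1) = _ := twist_apply_pos q 1 (by decide)
  have h2 := congrArg (tangent q 1) (e3.symm.trans h1)
  rw [map_smul, tangent_apply, deriv_x, counit_derivValue] at h2
  rw [if_pos (by decide), smul_eq_mul, mul_one] at h2
  exact hq (inv_eq_one.1 h2)

/-- The cocycle `∂_i ⌣ ∂_j`, with coefficients in `_σ A`. -/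
def cupDeriv (q : ℂˣ) (i j : SignType) (σ : Sphere q ≃ₐ[ℂ] Sphere q)
    (hσ : twist q j * twist q i = σ) : cocycles σ 2 :=
  ⟨cup (twist q j) (derivCocycle q i).1 (derivCocycle q j).1,
    hσ ▸ cup_mem_cocycles _ _ (derivCocycle q i).2 (derivCocycle q j).2⟩

theorem derivClass_mul_eq_class (q : ℂˣ) (i j : SignType) (σ : Sphere q ≃ₐ[ℂ] Sphere q)
    (hσ : twist q j * twist q i = σ) :
    derivClass q i * derivClass q j = cohomologyClass σ 2 (cupDeriv q i j σ hσ) := by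
  rw [derivClass, derivClass, cohomologyClass_mul]
  exact cohomologyClass_congr hσ _ _ rfl

/-- The grading separates `γ` from `α` and `β`. Then `ε ∘ ∂_1` detects `α`, `ε ∘ ∂_{-1}` detects
`β`, and `ε` detects `γ`. -/
theorem derivClass_mul_linearIndependent (q : ℂˣ) (hq : (q : ℂ) ^ 2 ≠ 1) (α β γ : ℂ)
    (h : α • (derivClass q (-1) * derivClass q 0) + β • (derivClass q 0 * derivClass q 1)
      + γ • (derivClass q (-1) * derivClass q 1) = 0) : α = 0 ∧ β = 0 ∧ γ = 0 := by
  have hq0 := q.ne_zero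
  rw [derivClass_mul_eq_class q (-1) 0 (twist q 1) (by rw [twist_zero, one_mul, twist_neg_one]),
    derivClass_mul_eq_class q 0 1 (twist q 1) (by rw [twist_zero, mul_one]),
    derivClass_mul_eq_class q (-1) 1 (twist q 1 * twist q 1) (by rw [twist_neg_one]),
    ← cohomologyClass_smul, ← cohomologyClass_smul, ← cohomologyClass_add,
    ← cohomologyClass_smul] at h
  have hne : deg 2 (twist q 1) ≠ deg 2 (twist q 1 * twist q 1) := by
    intro h
    have h1 : twist q 1 = twist q 1 * twist q 1 := congrArg Degree.twist h
    exact twist_one_ne_one q hq (mul_eq_left.1 h1.symm)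
  -- In a vanishing sum of classes of different degrees, each summand vanishes.
  have hz : ∀ (σ τ : Sphere q ≃ₐ[ℂ] Sphere q) (hne : deg 2 σ ≠ deg 2 τ) (φ : cocycles σ 2)
      (ψ : cocycles τ 2), cohomologyClass σ 2 φ + cohomologyClass τ 2 ψ = 0 →
      cohomologyClass σ 2 φ = 0 := by
    intro σ τ hne φ ψ h
    have h3 := DFunLike.congr_fun h (deg 2 σ)
    rw [DirectSum.add_apply, cohomologyClass, cohomologyClass, DirectSum.of_eq_same,
      DirectSum.of_eq_of_ne _ _ _ hne, add_zero] at h3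
    rw [cohomologyClass, h3]
    exact map_zero _
  have h1 := hz _ _ hne _ _ h
  have h2 := hz _ _ hne.symm _ _ ((add_comm _ _).trans h)
  rw [cohomologyClass_eq_zero_iff] at h1 h2
  obtain ⟨η, hη⟩ := h1
  obtain ⟨θ, hθ⟩ := h2
  have key : ∀ χ : Sphere q →ₗ[ℂ] ℂ, relationPairing q χ (coboundary (twist q 1) 1 η) =
      α * relationPairing q χ (cup (twist q 0) (derivCocycle q (-1)).1 (derivCocycle q 0).1)
        + β * relationPairing q χ (cup (twist q 1) (derivCocycle q 0).1 (derivCocycle q 1).1) := by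
    intro χ
    rw [hη, ← relationPairing_smul, ← relationPairing_smul, ← relationPairing_add]
    rfl
  have key' : relationPairing q (counit q).toLinearMap
      (coboundary (twist q 1 * twist q 1) 1 θ) =
      γ * relationPairing q (counit q).toLinearMap
        (cup (twist q 1) (derivCocycle q (-1)).1 (derivCocycle q 1).1) := by
    rw [hθ, ← relationPairing_smul]
    rfl
  have e1 := key (tangent q 1)
  have e2 := key (tangent q (-1))
  have e0 : ∀ i j, tangent q i (x q j) = if i = j ∧ i ≠ 0 then 1 else 0 := by
    intro i j
    rw [tangent_apply, deriv_x, counit_derivValue]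
  have ht : ∀ η, relationPairing q (tangent q (-1)) (coboundary (twist q 1) 1 η) = 0 := 
    relationPairing_tangent_coboundary q (-1)
  rw [relationPairing_tangent_coboundary, relationPairing_cup, relationPairing_cup] at e1
  rw [ht, relationPairing_cup, relationPairing_cup] at e2
  rw [relationPairing_counit_coboundary _ _ (by simp [counit_twist]), relationPairing_cup] at key'
  simp [tangent_mul, counit_derivValue, counit_twist, twist_zero, derivValue_zero_neg, derivValue_zero_pos, derivValue_zero_zero, e0,
    counit_x, hq0,
    show twist q 1 (x q (-1)) = _ from twist_apply_neg q 1 (by decide),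
    show twist q 1 (x q 1) = _ from twist_apply_pos q 1 (by decide)] at e1 e2 key'
  exact ⟨e1.symm, e2, key'.symm⟩


/-! ### The kernel from ordered monomials. -/

/-- The span of the ordered monomials of degree at most two. -/
def orderedSpan {B : Type*} [Ring B] [Algebra ℂ B] (y : SignType → B) : Submodule ℂ B :=
  Submodule.span ℂ
    {1, y (-1), y 0, y 1, y (-1) * y 0, y 0 * y 1, y (-1) * y 1}

/-- After reordering, a generator times a quadratic ordered monomial contains a square or is a
multiple of `y_{-1} y_0 y_1`, hence vanishes. The remaining products only need to be put in order.
-/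
theorem mul_mem_orderedSpan {B : Type*} [Ring B] [Algebra ℂ B] (y : SignType → B) (c : ℂ)
    (hs : ∀ i, y i * y i = 0) (h₁ : y 0 * y (-1) = -(y (-1) * y 0)) (h₂ : y 1 * y 0 = -(y 0 * y 1))
    (h₃ : y 1 * y (-1) = c • (y (-1) * y 1)) (h₄ : y (-1) * y 0 * y 1 = 0)
    (i : SignType) {b : B} (hb : b ∈ orderedSpan y) : y i * b ∈ orderedSpan y := by
  have hgen : ∀ b ∈ ({1, y (-1), y 0, y 1, y (-1) * y 0, y 0 * y 1, y (-1) * y 1} : Set B),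
      b ∈ orderedSpan y := fun b hb => Submodule.subset_span hb
  simp only [Set.forall_mem_insert, Set.mem_singleton_iff, forall_eq] at hgen
  obtain ⟨g1, gm, gz, gp, gmz, gzp, gmp⟩ := hgen
  induction hb using Submodule.span_induction with
  | zero => simp
  | add a b _ _ ha hb => rw [mul_add]; exact add_mem ha hb
  | smul k b _ hb => rw [mul_smul_comm]; exact Submodule.smul_mem _ _ hb
  | mem b hb =>
    have hi : i = -1 ∨ i = 0 ∨ i = 1 := by revert i; decide
    simp only [Set.mem_insert_iff, Set.mem_singleton_iff] at hb
    rcases hb with rfl | rfl | rfl | rfl | rfl | rfl | rfl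
    · rw [mul_one]
      rcases hi with rfl | rfl | rfl <;> assumption
    · rcases hi with rfl | rfl | rfl
      · rw [hs]; exact zero_mem _
      · rw [h₁]; exact neg_mem gmz
      · rw [h₃]; exact Submodule.smul_mem _ _ gmp
    · rcases hi with rfl | rfl | rfl
      · exact gmz
      · rw [hs]; exact zero_mem _
      · rw [h₂]; exact neg_mem gzp
    · rcases hi with rfl | rfl | rfl
      · exact gmp
      · exact gzp
      · rw [hs]; exact zero_mem _
    · convert zero_mem (orderedSpan y)
      rcases hi with rfl | rfl | rfl
      · rw [← mul_assoc, hs, zero_mul]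
      · rw [← mul_assoc, h₁, neg_mul, mul_assoc, hs, mul_zero, neg_zero]
      · rw [← mul_assoc, h₃, smul_mul_assoc, mul_assoc, h₂, mul_neg, ← mul_assoc, h₄, neg_zero,
          smul_zero]
    · convert zero_mem (orderedSpan y)
      rcases hi with rfl | rfl | rfl
      · rw [← mul_assoc, h₄]
      · rw [← mul_assoc, hs, zero_mul]
      · rw [← mul_assoc, h₂, neg_mul, mul_assoc, hs, mul_zero, neg_zero]
    · convert zero_mem (orderedSpan y)
      rcases hi with rfl | rfl | rfl
      · rw [← mul_assoc, hs, zero_mul]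
      · rw [← mul_assoc, h₁, neg_mul, h₄, neg_zero]
      · rw [← mul_assoc, h₃, smul_mul_assoc, mul_assoc, hs, mul_zero, smul_zero]

theorem lift_mem_orderedSpan {B : Type*} [Ring B] [Algebra ℂ B] (y : SignType → B) (c : ℂ)
    (hs : ∀ i, y i * y i = 0) (h₁ : y 0 * y (-1) = -(y (-1) * y 0)) (h₂ : y 1 * y 0 = -(y 0 * y 1))
    (h₃ : y 1 * y (-1) = c • (y (-1) * y 1)) (h₄ : y (-1) * y 0 * y 1 = 0)
    (r : FreeAlgebra ℂ SignType) : FreeAlgebra.lift ℂ y r ∈ orderedSpan y := by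
  suffices h : ∀ b ∈ orderedSpan y, FreeAlgebra.lift ℂ y r * b ∈ orderedSpan y by
    simpa using h 1 (Submodule.subset_span (by simp))
  induction r using FreeAlgebra.induction with
  | grade0 k =>
    intro b hb
    rw [AlgHom.commutes, ← Algebra.smul_def]
    exact Submodule.smul_mem _ _ hb
  | grade1 i =>
    intro b hb
    rw [FreeAlgebra.lift_ι_apply]
    exact mul_mem_orderedSpan y c hs h₁ h₂ h₃ h₄ i hb
  | mul r s hr hs =>
    intro b hb
    rw [map_mul, mul_assoc]
    exact hr _ (hs _ hb)
  | add r s hr hs =>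
    intro b hb
    rw [map_add, add_mul]
    exact add_mem (hr _ hb) (hs _ hb)

theorem exists_of_mem_orderedSpan {B : Type*} [Ring B] [Algebra ℂ B] (y : SignType → B) {b : B}
    (hb : b ∈ orderedSpan y) : ∃ c cm cz cp α β γ : ℂ,
      b = c • 1 + cm • y (-1) + cz • y 0 + cp • y 1 + α • (y (-1) * y 0) + β • (y 0 * y 1)
        + γ • (y (-1) * y 1) := by
  simp only [orderedSpan, Submodule.mem_span_insert, Submodule.mem_span_singleton] at hb
  obtain ⟨c, _, ⟨cm, _, ⟨cz, _, ⟨cp, _, ⟨α, _, ⟨β, _, ⟨γ, rfl⟩, rfl⟩, rfl⟩, rfl⟩, rfl⟩, rfl⟩, rfl⟩ :=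
    hb
  exact ⟨c, cm, cz, cp, α, β, γ, by abel⟩

/-- If the ordered monomials of degree two are linearly independent and those of degree three
vanish, then the ordered monomials of degree at most two are linearly independent. -/
theorem ordered_linearIndependent {B : Type*} [Ring B] [Algebra ℂ B] (y : SignType → B) (d : ℂ)
    (hs : ∀ i, y i * y i = 0) (h₁ : y 0 * y (-1) = -(y (-1) * y 0))
    (h₃ : y 1 * y (-1) = d • (y (-1) * y 1)) (h₄ : y (-1) * y 0 * y 1 = 0)
    (hind : ∀ α β γ : ℂ, α • (y (-1) * y 0) + β • (y 0 * y 1) + γ • (y (-1) * y 1) = 0 →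
      α = 0 ∧ β = 0 ∧ γ = 0) {c cm cz cp α β γ : ℂ}
    (h : c • 1 + cm • y (-1) + cz • y 0 + cp • y 1 + α • (y (-1) * y 0) + β • (y 0 * y 1)
        + γ • (y (-1) * y 1) = 0) :
    c = 0 ∧ cm = 0 ∧ cz = 0 ∧ cp = 0 ∧ α = 0 ∧ β = 0 ∧ γ = 0 := by
  have hs' : ∀ i b, y i * (y i * b) = 0 := fun i b => by rw [← mul_assoc, hs, zero_mul]
  have h₁' : ∀ b, y 0 * (y (-1) * b) = -(y (-1) * (y 0 * b)) := fun b => by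
    rw [← mul_assoc, h₁, neg_mul, mul_assoc]
  have h₃' : ∀ b, y 1 * (y (-1) * b) = d • (y (-1) * (y 1 * b)) := fun b => by
    rw [← mul_assoc, h₃, smul_mul_assoc, mul_assoc]
  have h₄' : y (-1) * (y 0 * y 1) = 0 := by rw [← mul_assoc, h₄]
  -- Each multiplier moves unknown coefficients into degree 2: `y_{-1} y_1` isolates `c`, then `y_1`
  -- on the right gives `cm` and `cz`, then `y_0` on the left gives `cp`.
  have e0 := congrArg (· * (y (-1) * y 1)) h
  have e1 := congrArg (· * y 1) h
  have e2 := congrArg (y 0 * ·) h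
  simp only [add_mul, mul_add, smul_mul_assoc, mul_smul_comm, one_mul, mul_one, mul_assoc, hs', h₁',
    h₃', h₄', hs, h₁, mul_zero, zero_mul, smul_zero, neg_zero, add_zero] at e0 e1 e2
  obtain ⟨-, -, rfl⟩ := hind 0 0 c (by simpa using e0)
  obtain ⟨-, rfl, rfl⟩ := hind 0 cz cm (by simpa [add_comm] using e1)
  obtain ⟨-, rfl, -⟩ := hind 0 cp 0 (by simpa using e2)
  obtain ⟨rfl, rfl, rfl⟩ := hind α β γ (by simpa using h)
  simp

/-- The relations of the quantum exterior algebra, together with its ordered cubic monomial. -/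
def exteriorRelations (q : ℂˣ) : Set (FreeAlgebra ℂ SignType) :=
  {r : FreeAlgebra ℂ SignType | ∃ i j : SignType, i ≤ j ∧
      r = FreeAlgebra.ι ℂ i * FreeAlgebra.ι ℂ j
        + (q : ℂ) ^ (2 * (i : ℤ) * (j : ℤ)) • (FreeAlgebra.ι ℂ j * FreeAlgebra.ι ℂ i)} ∪
    {FreeAlgebra.ι ℂ (-1) * FreeAlgebra.ι ℂ 0 * FreeAlgebra.ι ℂ 1}

theorem relations_of_exteriorRelations (q : ℂˣ) (hq : (q : ℂ) ^ 4 ≠ 1) {B : Type*} [Ring B]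
    [Algebra ℂ B] (y : SignType → B)
    (h : ∀ i j : SignType, i ≤ j → y i * y j = -((q : ℂ) ^ (2 * (i : ℤ) * (j : ℤ)) • (y j * y i))) :
    (∀ i, y i * y i = 0) ∧ y 0 * y (-1) = -(y (-1) * y 0) ∧ y 1 * y 0 = -(y 0 * y 1) ∧
      y 1 * y (-1) = (-(q : ℂ) ^ 2) • (y (-1) * y 1) := by
  have hq0 := q.ne_zero
  refine ⟨fun i => ?_, ?_, ?_, ?_⟩
  · have h1 : (1 + (q : ℂ) ^ (2 * (i : ℤ) * (i : ℤ))) • (y i * y i) = 0 := by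
      rw [add_smul, one_smul]
      exact eq_neg_iff_add_eq_zero.1 (h i i le_rfl)
    refine (smul_eq_zero.1 h1).resolve_left fun h0 => ?_
    have h2 : i = 0 ∨ (q : ℂ) ^ (2 * (i : ℤ) * (i : ℤ)) = (q : ℂ) ^ 2 := by
      cases i
      · exact Or.inl rfl
      · exact Or.inr rfl
      · exact Or.inr rfl
    rcases h2 with rfl | h2
    · norm_num at h0
    · rw [h2] at h0
      exact hq (by linear_combination ((q : ℂ) ^ 2 - 1) * h0)
  · simpa using (congrArg Neg.neg (h (-1) 0 (by decide))).symm
  · simpa using (congrArg Neg.neg (h 0 1 (by decide))).symm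
  · rw [h (-1) 1 (by decide), smul_neg, smul_smul]
    have : (q : ℂ) ^ (2 * ((-1 : SignType) : ℤ) * ((1 : SignType) : ℤ)) = ((q : ℂ) ^ 2)⁻¹ := by
      congr 1
    rw [this, neg_mul, mul_inv_cancel₀ (pow_ne_zero _ hq0), neg_smul, one_smul, neg_neg]

/-- Modulo the ideal every element is an ordered polynomial `p` of degree at most two. For an
element of the kernel, the image of `p` in `B` is zero, so independence in `B` forces all
coefficients of `p` to vanish. -/
theorem ker_lift_eq_span (q : ℂˣ) (hq : (q : ℂ) ^ 4 ≠ 1) {B : Type*} [Ring B]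
    [Algebra ℂ B] (y : SignType → B)
    (h : ∀ i j : SignType, i ≤ j → y i * y j = -((q : ℂ) ^ (2 * (i : ℤ) * (j : ℤ)) • (y j * y i)))
    (h₄ : y (-1) * y 0 * y 1 = 0)
    (hind : ∀ α β γ : ℂ, α • (y (-1) * y 0) + β • (y 0 * y 1) + γ • (y (-1) * y 1) = 0 →
      α = 0 ∧ β = 0 ∧ γ = 0) :
    TwoSidedIdeal.ker (FreeAlgebra.lift ℂ y) = TwoSidedIdeal.span (exteriorRelations q) := by
  have hle : TwoSidedIdeal.span (exteriorRelations q) ≤ TwoSidedIdeal.ker (FreeAlgebra.lift ℂ y) := by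
    rw [TwoSidedIdeal.span_le]
    rintro r (⟨i, j, hij, rfl⟩ | rfl)
    · rw [SetLike.mem_coe, TwoSidedIdeal.mem_ker]
      simp [h i j hij]
    · rw [SetLike.mem_coe, TwoSidedIdeal.mem_ker]
      simp [h₄]
  refine le_antisymm (fun r hr => ?_) hle
  set I := TwoSidedIdeal.span (exteriorRelations q) with hI
  -- The reduction to ordered monomials is applied to the generators of the quotient by `I`, which
  -- satisfy the relations by construction.
  let z : SignType → I.ringCon.Quotient := fun i => I.ringCon.mk' (FreeAlgebra.ι ℂ i)
  let π : FreeAlgebra ℂ SignType →ₐ[ℂ] I.ringCon.Quotient :=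
    { I.ringCon.mk' with commutes' := fun _ => rfl }
  have hπ : π = FreeAlgebra.lift ℂ z := FreeAlgebra.hom_ext (by ext i; simp [π, z])
  have hker : ∀ r, π r = 0 ↔ r ∈ I := fun r => by
    conv_rhs => rw [← TwoSidedIdeal.ker_ringCon_mk' I]
    rw [TwoSidedIdeal.mem_ker]
    rfl
  have hrel : ∀ r ∈ exteriorRelations q, FreeAlgebra.lift ℂ z r = 0 := fun r hr => by
    rw [← hπ, hker]
    exact TwoSidedIdeal.subset_span hr
  have hz : ∀ i j : SignType, i ≤ j →
      z i * z j = -((q : ℂ) ^ (2 * (i : ℤ) * (j : ℤ)) • (z j * z i)) := fun i j hij => by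
    have := hrel _ (Or.inl ⟨i, j, hij, rfl⟩)
    rw [← add_eq_zero_iff_eq_neg]
    simpa using this
  have hz₄ : z (-1) * z 0 * z 1 = 0 := by simpa using hrel _ (Or.inr rfl)
  obtain ⟨a1, a2, a3, a4⟩ := relations_of_exteriorRelations q hq z hz
  obtain ⟨b1, b2, b3, b4⟩ := relations_of_exteriorRelations q hq y h
  obtain ⟨c, cm, cz, cp, α, β, γ, e⟩ :=
    exists_of_mem_orderedSpan z (lift_mem_orderedSpan z _ a1 a2 a3 a4 hz₄ r)
  let p : (SignType → FreeAlgebra ℂ SignType) → FreeAlgebra ℂ SignType := fun ι =>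
    c • 1 + cm • ι (-1) + cz • ι 0 + cp • ι 1 + α • (ι (-1) * ι 0) + β • (ι 0 * ι 1)
        + γ • (ι (-1) * ι 1)
  have hp : r - p (FreeAlgebra.ι ℂ) ∈ I := by
    rw [← hker, hπ, map_sub, e]
    simp [p]
  have hp' := hle hp
  rw [TwoSidedIdeal.mem_ker] at hr hp'
  rw [map_sub, hr, zero_sub, neg_eq_zero] at hp'
  obtain ⟨rfl, rfl, rfl, rfl, rfl, rfl, rfl⟩ :=
    ordered_linearIndependent y _ b1 b2 b4 h₄ hind (by simpa [p] using hp')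
  simpa [p] using hp


/-! ### A model of the quantum sphere, graded by weight. -/

/-- The substitution `g(X) ↦ g(cX)`. -/
def dilate (c : ℂ) : ℂ[X] →ₐ[ℂ] ℂ[X] := aeval (C c * X)

theorem dilate_X (c : ℂ) : dilate c X = C c * X := aeval_X _

theorem dilate_C (c a : ℂ) : dilate c (C a) = C a := aeval_C _ _

theorem dilate_dilate (c d : ℂ) (h : c * d = 1) (g : ℂ[X]) : dilate c (dilate d g) = g := by
  have : (dilate c).comp (dilate d) = AlgHom.id ℂ _ := by
    ext1
    simp only [AlgHom.comp_apply, dilate_X, map_mul, dilate_C, AlgHom.id_apply]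
    rw [← mul_assoc, ← C_mul, mul_comm d c, h, C_1, one_mul]
  exact DFunLike.congr_fun this g

/-- The space `⨁_w ℂ[X]`, a model of `ℂ_q[S²]`: the summand of index `w ≥ 0` stands for
`ℂ[x_0] x_1^w`, the one of index `-w ≤ 0` for `ℂ[x_0] x_{-1}^w`. -/
abbrev Model : Type := ℤ →₀ ℂ[X]

/-- The operator on the model that maps the summand of index `w` to that of index `w + d` by
`f w`. -/
def shiftOp (d : ℤ) (f : ℤ → ℂ[X] →ₗ[ℂ] ℂ[X]) : Module.End ℂ Model :=
  Finsupp.lsum ℂ fun w => Finsupp.lsingle (w + d) ∘ₗ f w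

theorem shiftOp_single (d : ℤ) (f : ℤ → ℂ[X] →ₗ[ℂ] ℂ[X]) (w : ℤ) (g : ℂ[X]) :
    shiftOp d f (Finsupp.single w g) = Finsupp.single (w + d) (f w g) := by
  simp [shiftOp]

/-- `x_1 x_{-1}` as a polynomial in `x_0`. -/
def prodPosNeg (q : ℂˣ) : ℂ[X] := C (((q : ℂ) ^ 2)⁻¹) * X ^ 2 + C ((q : ℂ)⁻¹) * X

/-- `x_{-1} x_1` as a polynomial in `x_0`. -/
def prodNegPos (q : ℂˣ) : ℂ[X] := C ((q : ℂ) ^ 2) * X ^ 2 + C (q : ℂ) * X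

/-- This mirrors the associativity of `x_{-1} x_1 x_{-1}`: moving `x_{-1}` past a polynomial in
`x_0` dilates it by `q²`. -/
theorem dilate_prodPosNeg (q : ℂˣ) : dilate ((q : ℂ) ^ 2) (prodPosNeg q) = prodNegPos q := by
  have hq := q.ne_zero
  have h₁ : (C ((q : ℂ) ^ 2)⁻¹ * C ((q : ℂ) ^ 2) : ℂ[X]) = 1 := by
    rw [← C_mul, inv_mul_cancel₀ (pow_ne_zero _ hq), C_1]
  have h₂ : (C (q : ℂ)⁻¹ * C ((q : ℂ) ^ 2) : ℂ[X]) = C (q : ℂ) := by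
    rw [← C_mul]
    congr 1
    field_simp
  rw [prodPosNeg, prodNegPos, map_add, map_mul, map_mul, map_pow, dilate_C, dilate_C, dilate_X]
  linear_combination (C ((q : ℂ) ^ 2) * X ^ 2) * h₁ + X * h₂

theorem dilate_prodNegPos (q : ℂˣ) : dilate ((q : ℂ) ^ 2)⁻¹ (prodNegPos q) = prodPosNeg q := by
  rw [← dilate_prodPosNeg, dilate_dilate _ _ (inv_mul_cancel₀ (pow_ne_zero _ q.ne_zero))]

/-- The action of `x_1` on the model. -/
def modelPos (q : ℂˣ) : Module.End ℂ Model :=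
  shiftOp 1 fun w => LinearMap.mulLeft ℂ (if 0 ≤ w then 1 else prodPosNeg q) ∘ₗ
    (dilate ((q : ℂ) ^ 2)⁻¹).toLinearMap

/-- The action of `x_{-1}` on the model. -/
def modelNeg (q : ℂˣ) : Module.End ℂ Model :=
  shiftOp (-1) fun w => LinearMap.mulLeft ℂ (if w ≤ 0 then 1 else prodNegPos q) ∘ₗ
    (dilate ((q : ℂ) ^ 2)).toLinearMap

/-- Multiplication by a polynomial, the action of the corresponding polynomial in `x_0`. -/
def modelMul (g : ℂ[X]) : Module.End ℂ Model := shiftOp 0 fun _ => LinearMap.mulLeft ℂ g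

theorem modelPos_single (q : ℂˣ) (w : ℤ) (g : ℂ[X]) :
    modelPos q (Finsupp.single w g) =
      Finsupp.single (w + 1) ((if 0 ≤ w then 1 else prodPosNeg q) * dilate ((q : ℂ) ^ 2)⁻¹ g) :=
  shiftOp_single _ _ _ _

theorem modelNeg_single (q : ℂˣ) (w : ℤ) (g : ℂ[X]) :
    modelNeg q (Finsupp.single w g) =
      Finsupp.single (w - 1) ((if w ≤ 0 then 1 else prodNegPos q) * dilate ((q : ℂ) ^ 2) g) :=
  shiftOp_single _ _ _ _

theorem modelMul_single (f : ℂ[X]) (w : ℤ) (g : ℂ[X]) :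
    modelMul f (Finsupp.single w g) = Finsupp.single w (f * g) := by
  rw [modelMul, shiftOp_single, add_zero]
  rfl

theorem model_hom_ext {M : Type*} [AddCommGroup M] [Module ℂ M] {S T : Model →ₗ[ℂ] M}
    (h : ∀ w g, S (Finsupp.single w g) = T (Finsupp.single w g)) : S = T :=
  Finsupp.lhom_ext h

theorem modelPos_comp_modelNeg (q : ℂˣ) : modelPos q * modelNeg q = modelMul (prodPosNeg q) := by
  have hq2 := pow_ne_zero 2 q.ne_zero
  refine model_hom_ext fun w g => ?_
  rw [Module.End.mul_apply, modelNeg_single, modelPos_single, modelMul_single, sub_add_cancel,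
    map_mul, dilate_dilate _ _ (inv_mul_cancel₀ hq2)]
  by_cases h : w ≤ 0
  · rw [if_neg (by omega), if_pos h, map_one, one_mul]
  · rw [if_pos (by omega), if_neg h, dilate_prodNegPos, one_mul]

theorem modelNeg_comp_modelPos (q : ℂˣ) : modelNeg q * modelPos q = modelMul (prodNegPos q) := by
  have hq2 := pow_ne_zero 2 q.ne_zero
  refine model_hom_ext fun w g => ?_
  rw [Module.End.mul_apply, modelPos_single, modelNeg_single, modelMul_single, add_sub_cancel_right,
    map_mul, dilate_dilate _ _ (mul_inv_cancel₀ hq2)]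
  by_cases h : 0 ≤ w
  · rw [if_neg (by omega), if_pos h, map_one, one_mul]
  · rw [if_pos (by omega), if_neg h, dilate_prodPosNeg, one_mul]

theorem modelPos_comp_modelMul (q : ℂˣ) (f : ℂ[X]) :
    modelPos q * modelMul f = modelMul (dilate ((q : ℂ) ^ 2)⁻¹ f) * modelPos q := by
  refine model_hom_ext fun w g => ?_
  rw [Module.End.mul_apply, Module.End.mul_apply, modelPos_single, modelMul_single,
    modelMul_single, modelPos_single, map_mul, mul_left_comm]

theorem modelNeg_comp_modelMul (q : ℂˣ) (f : ℂ[X]) :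
    modelNeg q * modelMul f = modelMul (dilate ((q : ℂ) ^ 2) f) * modelNeg q := by
  refine model_hom_ext fun w g => ?_
  rw [Module.End.mul_apply, Module.End.mul_apply, modelNeg_single, modelMul_single,
    modelMul_single, modelNeg_single, map_mul, mul_left_comm]

theorem modelMul_mul (f g : ℂ[X]) : modelMul (f * g) = modelMul f * modelMul g :=
  model_hom_ext fun w k => by
    rw [Module.End.mul_apply, modelMul_single, modelMul_single, modelMul_single, mul_assoc]

theorem modelMul_add (f g : ℂ[X]) : modelMul (f + g) = modelMul f + modelMul g :=
  model_hom_ext fun w k => by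
    rw [LinearMap.add_apply, modelMul_single, modelMul_single, modelMul_single, add_mul,
      Finsupp.single_add]

theorem modelMul_C (c : ℂ) : modelMul (C c) = c • 1 :=
  model_hom_ext fun w k => by
    rw [LinearMap.smul_apply, modelMul_single, Module.End.one_apply, Finsupp.smul_single,
      smul_eq_C_mul]

/-- The action of the generators on the model. -/
def modelGen (q : ℂˣ) : SignType → Module.End ℂ Model
  | .pos => modelPos q
  | .zero => modelMul X
  | .neg => modelNeg q

/-- The action of `ℂ_q[S²]` on the model. -/
def modelRep (q : ℂˣ) : Sphere q →ₐ[ℂ] Module.End ℂ Model :=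
  lift q (modelGen q)
    (fun s hs => by
      obtain rfl | rfl : s = -1 ∨ s = 1 := by revert s; decide
      · change modelNeg q * modelMul X = _ • (modelMul X * modelNeg q)
        rw [modelNeg_comp_modelMul, dilate_X, modelMul_mul, modelMul_C, smul_mul_assoc, one_mul,
          smul_mul_assoc]
        simp
      · change modelPos q * modelMul X = _ • (modelMul X * modelPos q)
        rw [modelPos_comp_modelMul, dilate_X, modelMul_mul, modelMul_C, smul_mul_assoc, one_mul,
          smul_mul_assoc]
        congr 1)
    (fun s hs => by
      obtain rfl | rfl : s = -1 ∨ s = 1 := by revert s; decide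
      · change modelNeg q * modelPos q = _ • modelMul X ^ 2 + _ • modelMul X
        rw [modelNeg_comp_modelPos, prodNegPos, modelMul_add, modelMul_mul, modelMul_mul, modelMul_C,
          modelMul_C, smul_mul_assoc, one_mul, smul_mul_assoc, one_mul, pow_two X, modelMul_mul,
          pow_two (modelMul X)]
        simp
      · change modelPos q * modelNeg q = _ • modelMul X ^ 2 + _ • modelMul X
        rw [modelPos_comp_modelNeg, prodPosNeg, modelMul_add, modelMul_mul, modelMul_mul, modelMul_C,
          modelMul_C, smul_mul_assoc, one_mul, smul_mul_assoc, one_mul, pow_two X, modelMul_mul,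
          pow_two (modelMul X)]
        congr 2
        simp)

theorem modelRep_zero (q : ℂˣ) : modelRep q (x q 0) = modelMul X := lift_x _ _ _ _ _

theorem modelRep_pos (q : ℂˣ) : modelRep q (x q 1) = modelPos q := lift_x _ _ _ _ _

theorem modelRep_neg (q : ℂˣ) : modelRep q (x q (-1)) = modelNeg q := lift_x _ _ _ _ _

/-- `x_1^w` for `w ≥ 0` and `x_{-1}^{-w}` for `w < 0`. -/
def weightMonomial (q : ℂˣ) : ℤ → Sphere q
  | .ofNat n => x q 1 ^ n
  | .negSucc n => x q (-1) ^ (n + 1)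

/-- The linear map from the model to `ℂ_q[S²]`. -/
def ofModel (q : ℂˣ) : Model →ₗ[ℂ] Sphere q :=
  Finsupp.lsum ℂ fun w =>
    LinearMap.mulRight ℂ (weightMonomial q w) ∘ₗ (aeval (x q 0)).toLinearMap

theorem ofModel_single (q : ℂˣ) (w : ℤ) (g : ℂ[X]) :
    ofModel q (Finsupp.single w g) = aeval (x q 0) g * weightMonomial q w := by
  simp [ofModel]

theorem mul_aeval_of_comm (q : ℂˣ) (c : ℂ) (a : Sphere q)
    (h : a * x q 0 = c • (x q 0 * a)) (g : ℂ[X]) :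
    a * aeval (x q 0) g = aeval (x q 0) (dilate c g) * a := by
  induction g using Polynomial.induction_on with
  | C k => simp [dilate_C, Algebra.commutes]
  | add f g hf hg => simp [mul_add, add_mul, hf, hg]
  | monomial n k ih =>
    rw [pow_succ, ← mul_assoc, map_mul, ← mul_assoc, ih, mul_assoc, aeval_X, h,
      map_mul (dilate c) _ X, map_mul _ _ (dilate c X), dilate_X, map_mul _ (C c) X, aeval_X,
      aeval_C, Algebra.algebraMap_eq_smul_one]
    simp only [mul_assoc, smul_mul_assoc, one_mul]

theorem pos_mul_aeval (q : ℂˣ) (g : ℂ[X]) :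
    x q 1 * aeval (x q 0) g = aeval (x q 0) (dilate ((q : ℂ) ^ 2)⁻¹ g) * x q 1 :=
  mul_aeval_of_comm q _ _ (x_pos_zero q) g

theorem neg_mul_aeval (q : ℂˣ) (g : ℂ[X]) :
    x q (-1) * aeval (x q 0) g = aeval (x q 0) (dilate ((q : ℂ) ^ 2) g) * x q (-1) :=
  mul_aeval_of_comm q _ _ (x_neg_zero q) g

theorem aeval_prodPosNeg (q : ℂˣ) : aeval (x q 0) (prodPosNeg q) = x q 1 * x q (-1) := by
  rw [x_pos_neg, prodPosNeg]
  simp [pow_two, Algebra.smul_def]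

theorem aeval_prodNegPos (q : ℂˣ) : aeval (x q 0) (prodNegPos q) = x q (-1) * x q 1 := by
  rw [x_neg_pos, prodNegPos]
  simp [pow_two, Algebra.smul_def]

theorem pos_mul_weightMonomial (q : ℂˣ) (w : ℤ) :
    x q 1 * weightMonomial q w =
      aeval (x q 0) (if 0 ≤ w then 1 else prodPosNeg q) * weightMonomial q (w + 1) := by
  rcases w with n | n
  · rw [if_pos (by simp), map_one, one_mul]
    exact (pow_succ' _ _).symm
  · rw [if_neg (by simp), aeval_prodPosNeg]
    have : weightMonomial q (Int.negSucc n + 1) = x q (-1) ^ n := by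
      cases n with
      | zero =>
        rw [show Int.negSucc 0 + 1 = Int.ofNat 0 by decide, weightMonomial, pow_zero, pow_zero]
      | succ n => rfl
    rw [this, weightMonomial, pow_succ', mul_assoc]

theorem neg_mul_weightMonomial (q : ℂˣ) (w : ℤ) :
    x q (-1) * weightMonomial q w =
      aeval (x q 0) (if w ≤ 0 then 1 else prodNegPos q) * weightMonomial q (w - 1) := by
  rcases w with n | n
  · cases n with
    | zero =>
      rw [if_pos (by simp), map_one, one_mul]
      rw [show Int.ofNat 0 - 1 = Int.negSucc 0 by decide, weightMonomial, weightMonomial, pow_zero,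
        mul_one, zero_add, pow_one]
    | succ n =>
      rw [if_neg (by simp), aeval_prodNegPos]
      have : weightMonomial q (Int.ofNat (n + 1) - 1) = x q 1 ^ n := by
        simp [weightMonomial]
      rw [this, weightMonomial, pow_succ', mul_assoc]
  · rw [if_pos (Int.negSucc_lt_zero n).le, map_one, one_mul]
    exact (pow_succ' _ _).symm

theorem ofModel_modelMul (q : ℂˣ) (f : ℂ[X]) (v : Model) :
    ofModel q (modelMul f v) = aeval (x q 0) f * ofModel q v := by
  have : ofModel q ∘ₗ modelMul f = LinearMap.mulLeft ℂ (aeval (x q 0) f) ∘ₗ ofModel q :=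
    model_hom_ext fun w g => by
      rw [LinearMap.comp_apply, LinearMap.comp_apply, modelMul_single, ofModel_single,
        ofModel_single, map_mul, mul_assoc, LinearMap.mulLeft_apply]
  exact DFunLike.congr_fun this v

/-- The action on the model was defined by normal ordering `x_i · g(x_0) x_{±1}^n`, so the
generators are intertwined by design. Linearity and multiplicativity in `a` do the rest. -/
theorem ofModel_modelRep (q : ℂˣ) (a : Sphere q) (v : Model) :
    ofModel q (modelRep q a v) = a * ofModel q v := by
  induction a using sphere_induction generalizing v with
  | hc c => simp [Algebra.algebraMap_eq_smul_one]
  | hx i =>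
    suffices h : ofModel q ∘ₗ modelRep q (x q i) = LinearMap.mulLeft ℂ (x q i) ∘ₗ ofModel q from
      DFunLike.congr_fun h v
    refine model_hom_ext fun w g => ?_
    simp only [LinearMap.comp_apply, LinearMap.mulLeft_apply, ofModel_single]
    obtain rfl | rfl | rfl : i = -1 ∨ i = 0 ∨ i = 1 := by revert i; decide
    · rw [modelRep_neg, modelNeg_single, ofModel_single, ← mul_assoc, neg_mul_aeval, mul_assoc,
        neg_mul_weightMonomial, mul_comm _ (dilate _ _), map_mul, mul_assoc]
    · rw [modelRep_zero, modelMul_single, ofModel_single, map_mul, aeval_X, mul_assoc]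
    · rw [modelRep_pos, modelPos_single, ofModel_single, ← mul_assoc, pos_mul_aeval, mul_assoc,
        pos_mul_weightMonomial, mul_comm _ (dilate _ _), map_mul, mul_assoc]
  | hadd a b ha hb => simp [ha, hb, add_mul]
  | hmul a b ha hb => simp [ha, hb, mul_assoc]

/-- The linear map from `ℂ_q[S²]` to the model, the action on the summand of index `0`. -/
def toModel (q : ℂˣ) : Sphere q →ₗ[ℂ] Model :=
  LinearMap.applyₗ (Finsupp.single 0 1) ∘ₗ (modelRep q).toLinearMap

theorem toModel_one (q : ℂˣ) : toModel q 1 = Finsupp.single 0 1 := by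
  simp [toModel]

theorem toModel_mul (q : ℂˣ) (a b : Sphere q) : toModel q (a * b) = modelRep q a (toModel q b) := by
  simp [toModel]

/-- By equivariance, since the vector generating `toModel` goes to `1`. This one-sided inverse is
what the transport of operators to the algebra rests on. -/
theorem ofModel_toModel (q : ℂˣ) (a : Sphere q) : ofModel q (toModel q a) = a := by
  rw [← mul_one a, toModel_mul, ofModel_modelRep, toModel_one, ofModel_single]
  simp [weightMonomial]


/-! ### Truncated division operators and their exchange rules. -/

/-- The weight operator on the model. -/
def modelWeight : Module.End ℂ Model := shiftOp 0 fun w => (w : ℂ) • LinearMap.id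

theorem modelWeight_single (w : ℤ) (g : ℂ[X]) :
    modelWeight (Finsupp.single w g) = Finsupp.single w ((w : ℂ) • g) := by
  rw [modelWeight, shiftOp_single, add_zero]
  rfl

/-- A truncated inverse of `x_1` on the model, weighted by the degree in `x_1`. -/
def modelLower (q : ℂˣ) : Module.End ℂ Model :=
  shiftOp (-1) fun w => (if 1 ≤ w then (w : ℂ) else 0) •
    (LinearMap.mulLeft ℂ (1 + C (q : ℂ) * X) ∘ₗ (dilate ((q : ℂ) ^ 2)).toLinearMap)

/-- A truncated inverse of `x_{-1}` on the model, weighted by the degree in `x_{-1}`. -/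
def modelRaise (q : ℂˣ) : Module.End ℂ Model :=
  shiftOp 1 fun w => (if w ≤ -1 then (w + 1 : ℂ) else 0) •
    (LinearMap.mulLeft ℂ (1 + C (q : ℂ)⁻¹ * X) ∘ₗ (dilate ((q : ℂ) ^ 2)⁻¹).toLinearMap)

theorem modelLower_single (q : ℂˣ) (w : ℤ) (g : ℂ[X]) :
    modelLower q (Finsupp.single w g) = Finsupp.single (w - 1) ((if 1 ≤ w then (w : ℂ) else 0) •
      ((1 + C (q : ℂ) * X) * dilate ((q : ℂ) ^ 2) g)) :=
  shiftOp_single _ _ _ _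

theorem modelRaise_single (q : ℂˣ) (w : ℤ) (g : ℂ[X]) :
    modelRaise q (Finsupp.single w g) =
      Finsupp.single (w + 1) ((if w ≤ -1 then (w + 1 : ℂ) else 0) •
        ((1 + C (q : ℂ)⁻¹ * X) * dilate ((q : ℂ) ^ 2)⁻¹ g)) :=
  shiftOp_single _ _ _ _

theorem dilate_lowerFactor (q : ℂˣ) :
    dilate ((q : ℂ) ^ 2)⁻¹ (1 + C (q : ℂ) * X) = 1 + C (q : ℂ)⁻¹ * X := by
  have hq := q.ne_zero
  rw [map_add, map_one, map_mul, dilate_C, dilate_X, ← mul_assoc, ← C_mul]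
  congr 3
  field_simp

theorem dilate_raiseFactor (q : ℂˣ) :
    dilate ((q : ℂ) ^ 2) (1 + C (q : ℂ)⁻¹ * X) = 1 + C (q : ℂ) * X := by
  rw [← dilate_lowerFactor, dilate_dilate _ _ (mul_inv_cancel₀ (pow_ne_zero _ q.ne_zero))]

/-- On weights `w ≥ 1` only the first summand contributes and on `w ≤ 0` only the second, each with
coefficient `w`. The shift `w + 1` in `modelRaise` is made for this, as it is applied in weight `w -
1`. The factor `1 + q^{-1} X` is the cofactor of `q^{-1} X` in `x_1 x_{-1}`. -/
theorem modelPos_modelLower (q : ℂˣ) :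
    modelPos q * modelLower q + modelRaise q * modelNeg q =
      modelMul (1 + C (q : ℂ)⁻¹ * X) * modelWeight := by
  have hq2 := pow_ne_zero 2 q.ne_zero
  refine model_hom_ext fun w g => ?_
  simp only [LinearMap.add_apply, Module.End.mul_apply]
  rw [modelLower_single, modelPos_single, modelNeg_single, modelRaise_single, sub_add_cancel,
    modelWeight_single, modelMul_single, ← Finsupp.single_add, map_smul, map_mul, map_mul,
    dilate_lowerFactor, dilate_dilate _ _ (inv_mul_cancel₀ hq2)]
  congr 1
  by_cases h : 1 ≤ w
  · rw [if_pos h, if_pos (show 0 ≤ w - 1 by omega), if_neg (show ¬w - 1 ≤ -1 by omega)]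
    simp
  · rw [if_neg h, if_pos (show w - 1 ≤ -1 by omega), if_pos (show w ≤ 0 by omega)]
    simp

/-- The same division of labour, now with `w ≥ 0` covered by `modelLower` after `x_1` and `w ≤ -1`
by `modelRaise`; the common coefficient is `w + 1`. -/
theorem modelNeg_modelRaise (q : ℂˣ) :
    modelNeg q * modelRaise q + modelLower q * modelPos q =
      modelMul (1 + C (q : ℂ) * X) * (modelWeight + 1) := by
  have hq2 := pow_ne_zero 2 q.ne_zero
  refine model_hom_ext fun w g => ?_
  simp only [LinearMap.add_apply, Module.End.mul_apply, Module.End.one_apply]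
  rw [modelRaise_single, modelNeg_single, modelPos_single, modelLower_single, add_sub_cancel_right,
    modelWeight_single, ← Finsupp.single_add, ← Finsupp.single_add, modelMul_single, map_smul,
    map_mul, map_mul, dilate_raiseFactor, dilate_dilate _ _ (mul_inv_cancel₀ hq2)]
  congr 1
  by_cases h : 0 ≤ w
  · rw [if_neg (show ¬w ≤ -1 by omega), if_pos (show 1 ≤ w + 1 by omega), if_pos h]
    simp only [zero_smul, mul_zero, zero_add, map_one, one_mul]
    push_cast
    rw [add_smul, one_smul, mul_add, mul_smul_comm]
  · rw [if_pos (show w + 1 ≤ 0 by omega), if_pos (show w ≤ -1 by omega),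
      if_neg (show ¬1 ≤ w + 1 by omega)]
    simp only [zero_smul, add_zero, one_mul, mul_add, mul_smul_comm, add_smul, one_smul]

theorem modelLower_comp_modelMul (q : ℂˣ) (f : ℂ[X]) :
    modelLower q * modelMul f = modelMul (dilate ((q : ℂ) ^ 2) f) * modelLower q := by
  refine model_hom_ext fun w g => ?_
  rw [Module.End.mul_apply, Module.End.mul_apply, modelLower_single, modelMul_single,
    modelMul_single, modelLower_single, map_mul, mul_smul_comm, mul_left_comm]

theorem modelRaise_comp_modelMul (q : ℂˣ) (f : ℂ[X]) :
    modelRaise q * modelMul f = modelMul (dilate ((q : ℂ) ^ 2)⁻¹ f) * modelRaise q := by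
  refine model_hom_ext fun w g => ?_
  rw [Module.End.mul_apply, Module.End.mul_apply, modelRaise_single, modelMul_single,
    modelMul_single, modelRaise_single, map_mul, mul_smul_comm, mul_left_comm]

theorem deriv_zero_mul (q : ℂˣ) (a b : Sphere q) :
    deriv q 0 (a * b) = a * deriv q 0 b + deriv q 0 a * b := by
  rw [deriv_mul, twist_zero, AlgEquiv.one_apply]

theorem deriv_zero_pow (q : ℂˣ) (c : ℂ) (a : Sphere q) (h : deriv q 0 a = c • a) (n : ℕ) :
    deriv q 0 (a ^ n) = (n * c : ℂ) • a ^ n := by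
  induction n with
  | zero => simp [deriv_one]
  | succ n ih =>
    rw [pow_succ, deriv_zero_mul, ih, h, mul_smul_comm, smul_mul_assoc, ← add_smul]
    congr 1
    push_cast
    ring

theorem deriv_zero_weightMonomial (q : ℂˣ) (w : ℤ) :
    deriv q 0 (weightMonomial q w) = (w : ℂ) • weightMonomial q w := by
  rcases w with n | n
  · rw [weightMonomial, deriv_zero_pow q 1 (x q 1) (by rw [deriv_x, derivValue_zero_pos, one_smul]),
      mul_one]
    rfl
  · rw [weightMonomial, deriv_zero_pow q (-1) (x q (-1))
      (by rw [deriv_x, derivValue_zero_neg, neg_smul, one_smul])]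
    congr 1
    push_cast
    ring

theorem deriv_zero_aeval (q : ℂˣ) (g : ℂ[X]) : deriv q 0 (aeval (x q 0) g) = 0 := by
  induction g using Polynomial.induction_on with
  | C k => rw [aeval_C, deriv_algebraMap]
  | add f g hf hg => rw [map_add, map_add, hf, hg, add_zero]
  | monomial n k ih =>
    rw [pow_succ, ← mul_assoc, map_mul, deriv_zero_mul, ih, aeval_X, deriv_x,
      derivValue_zero_zero, mul_zero, zero_mul, add_zero]

/-- `∂_0` is the weight derivation: it kills polynomials in `x_0` and multiplies `x_{±1}^n` by `±n`.
-/
theorem ofModel_modelWeight (q : ℂˣ) (v : Model) :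
    ofModel q (modelWeight v) = deriv q 0 (ofModel q v) := by
  have : ofModel q ∘ₗ modelWeight = deriv q 0 ∘ₗ ofModel q :=
    model_hom_ext fun w g => by
      rw [LinearMap.comp_apply, LinearMap.comp_apply, modelWeight_single, ofModel_single,
        ofModel_single, deriv_zero_mul, deriv_zero_aeval, deriv_zero_weightMonomial]
      simp
  exact DFunLike.congr_fun this v

/-- The operator on `ℂ_q[S²]` induced by an operator on the model. -/
def transport (q : ℂˣ) (T : Module.End ℂ Model) : Sphere q →ₗ[ℂ] Sphere q :=
  ofModel q ∘ₗ T ∘ₗ toModel q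

theorem transport_apply (q : ℂˣ) (T : Module.End ℂ Model) (a : Sphere q) :
    transport q T a = ofModel q (T (toModel q a)) := rfl

theorem transport_rep_mul (q : ℂˣ) (T : Module.End ℂ Model) (a b : Sphere q) :
    transport q (modelRep q a * T) b = a * transport q T b := by
  rw [transport_apply, Module.End.mul_apply, ofModel_modelRep, transport_apply]

theorem transport_mul_rep (q : ℂˣ) (T : Module.End ℂ Model) (a b : Sphere q) :
    transport q (T * modelRep q a) b = transport q T (a * b) := by
  rw [transport_apply, Module.End.mul_apply, ← toModel_mul, transport_apply]

theorem transport_modelMul_mul (q : ℂˣ) (f : ℂ[X]) (T : Module.End ℂ Model) (b : Sphere q) :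
    transport q (modelMul f * T) b = aeval (x q 0) f * transport q T b := by
  rw [transport_apply, Module.End.mul_apply, ofModel_modelMul, transport_apply]

theorem transport_modelWeight (q : ℂˣ) (b : Sphere q) :
    transport q modelWeight b = deriv q 0 b := by
  rw [transport_apply, ofModel_modelWeight, ofModel_toModel]

theorem transport_one (q : ℂˣ) (b : Sphere q) : transport q 1 b = b :=
  ofModel_toModel q b

theorem transport_add (q : ℂˣ) (S T : Module.End ℂ Model) (b : Sphere q) :
    transport q (S + T) b = transport q S b + transport q T b := by
  simp [transport_apply]

/-- A truncated left division by `x_1`, weighted by the degree in `x_1`. -/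
def lower (q : ℂˣ) : Sphere q →ₗ[ℂ] Sphere q := transport q (modelLower q)

/-- A truncated left division by `x_{-1}`, weighted by the degree in `x_{-1}`. -/
def raise (q : ℂˣ) : Sphere q →ₗ[ℂ] Sphere q := transport q (modelRaise q)

theorem lower_one (q : ℂˣ) : lower q 1 = 0 := by
  rw [lower, transport_apply, toModel_one, modelLower_single]
  simp

theorem raise_one (q : ℂˣ) : raise q 1 = 0 := by
  rw [raise, transport_apply, toModel_one, modelRaise_single]
  simp

theorem lower_zero_mul (q : ℂˣ) (a : Sphere q) :
    lower q (x q 0 * a) = (q : ℂ) ^ 2 • (x q 0 * lower q a) := by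
  rw [lower, ← transport_mul_rep, modelRep_zero, modelLower_comp_modelMul, transport_modelMul_mul,
    dilate_X, map_mul, aeval_C, aeval_X, ← Algebra.smul_def, smul_mul_assoc]

theorem raise_zero_mul (q : ℂˣ) (a : Sphere q) :
    raise q (x q 0 * a) = ((q : ℂ) ^ 2)⁻¹ • (x q 0 * raise q a) := by
  rw [raise, ← transport_mul_rep, modelRep_zero, modelRaise_comp_modelMul, transport_modelMul_mul,
    dilate_X, map_mul, aeval_C, aeval_X, ← Algebra.smul_def, smul_mul_assoc]

/-- Together with `lower_pos_mul`, this trades one division operator for the other at the cost of a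
multiple of `∂_0`, as needed in the sphere relations. -/
theorem raise_neg_mul (q : ℂˣ) (a : Sphere q) :
    raise q (x q (-1) * a) =
      (1 + (q : ℂ)⁻¹ • x q 0) * deriv q 0 a - x q 1 * lower q a := by
  rw [eq_sub_iff_add_eq, add_comm, lower, raise, ← transport_rep_mul, ← transport_mul_rep,
    ← transport_add, modelRep_pos, modelRep_neg, modelPos_modelLower, transport_modelMul_mul,
    transport_modelWeight]
  simp [Algebra.smul_def]

theorem lower_pos_mul (q : ℂˣ) (a : Sphere q) :
    lower q (x q 1 * a) =
      (1 + (q : ℂ) • x q 0) * (deriv q 0 a + a) - x q (-1) * raise q a := by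
  rw [eq_sub_iff_add_eq, add_comm, lower, raise, ← transport_rep_mul, ← transport_mul_rep,
    ← transport_add, modelRep_pos, modelRep_neg, modelNeg_modelRaise, transport_modelMul_mul,
    transport_add, transport_modelWeight, transport_one]
  simp [Algebra.smul_def]


/-! ### Square-zero extensions and primitives of 3-cocycles. -/

/-- A normalized 2-cocycle `ψ` of `A` with coefficients in `_σ A`, together with a derivation `D`
of `A`. -/
structure CocycleWithDerivation (k : Type*) [Field k] (A : Type*) [Ring A] [Algebra k A] where
  /-- The twist. -/
  σ : A ≃ₐ[k] A
  /-- The cocycle. -/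
  ψ : A →ₗ[k] A →ₗ[k] A
  /-- The derivation. -/
  D : A →ₗ[k] A
  D_mul : ∀ a b, D (a * b) = a * D b + D a * b
  ψ_one_left : ∀ a, ψ 1 a = 0
  ψ_one_right : ∀ a, ψ a 1 = 0
  cocycle : ∀ a b c, σ a * ψ b c + ψ a (b * c) = ψ (a * b) c + ψ a b * c

/-- The linear endomorphisms of `A` that vanish at `1`. -/
def normalizedMaps (k : Type*) [Field k] (A : Type*) [Ring A] [Algebra k A] :
    Submodule k (A →ₗ[k] A) :=
  LinearMap.ker (LinearMap.applyₗ (1 : A))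

theorem mem_normalizedMaps {k : Type*} [Field k] {A : Type*} [Ring A] [Algebra k A]
    {n : A →ₗ[k] A} : n ∈ normalizedMaps k A ↔ n 1 = 0 := Iff.rfl

namespace CocycleWithDerivation

variable {k : Type*} [Field k] {A : Type*} [Ring A] [Algebra k A]

/-- The extension of `A` by the bimodule of endomorphisms `n` of `A` with `n(1) = 0` and `(a n b)(c) = σ(a) (n(bc) - n(b)c)` that
belongs to the 2-cocycle `(a, b) ↦ ψ(a, b) D`. -/
def Extension (_ : CocycleWithDerivation k A) : Type _ := A × normalizedMaps k A

variable (p : CocycleWithDerivation k A)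

instance : AddCommGroup p.Extension := inferInstanceAs (AddCommGroup (A × normalizedMaps k A))

instance : Module k p.Extension := inferInstanceAs (Module k (A × normalizedMaps k A))

theorem D_one : p.D 1 = 0 := by
  simpa using p.D_mul 1 1

/-- There is no product of the two second components, so they form a square-zero ideal. The
subtracted term belongs to the right action and keeps the value at `1` equal to zero. -/
instance : Mul p.Extension where
  mul u v := (u.1 * v.1, ⟨LinearMap.mulLeft k (p.σ u.1) ∘ₗ v.2.1 + u.2.1 ∘ₗ LinearMap.mulLeft k v.1
    - LinearMap.mulLeft k (u.2.1 v.1) + LinearMap.mulLeft k (p.ψ u.1 v.1) ∘ₗ p.D, by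
      rw [mem_normalizedMaps]
      simp [mem_normalizedMaps.1 v.2.2, p.D_one]⟩)

instance : One p.Extension where
  one := (1, 0)

variable {p}

theorem Extension.ext {u v : p.Extension} (h₁ : u.1 = v.1) (h₂ : ∀ c, u.2.1 c = v.2.1 c) : u = v :=
  Prod.ext h₁ (Subtype.ext (LinearMap.ext h₂))

theorem Extension.mul_fst (u v : p.Extension) : (u * v).1 = u.1 * v.1 := rfl

theorem Extension.mul_snd (u v : p.Extension) (c : A) :
    (u * v).2.1 c = p.σ u.1 * v.2.1 c + u.2.1 (v.1 * c) - u.2.1 v.1 * c + p.ψ u.1 v.1 * p.D c := rfl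

theorem Extension.one_fst : (1 : p.Extension).1 = 1 := rfl

theorem Extension.one_snd (c : A) : (1 : p.Extension).2.1 c = 0 := rfl

theorem Extension.add_fst (u v : p.Extension) : (u + v).1 = u.1 + v.1 := rfl

theorem Extension.add_snd (u v : p.Extension) (c : A) : (u + v).2.1 c = u.2.1 c + v.2.1 c := rfl

theorem Extension.zero_fst : (0 : p.Extension).1 = 0 := rfl

theorem Extension.zero_snd (c : A) : (0 : p.Extension).2.1 c = 0 := rfl

theorem Extension.smul_fst (r : k) (u : p.Extension) : (r • u).1 = r • u.1 := rfl

theorem Extension.smul_snd (r : k) (u : p.Extension) (c : A) : (r • u).2.1 c = r • u.2.1 c := rfl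

instance : Ring p.Extension where
  __ := (inferInstance : AddCommGroup p.Extension)
  __ := (inferInstance : Mul p.Extension)
  __ := (inferInstance : One p.Extension)
  left_distrib u v w := Extension.ext (mul_add _ _ _) fun c => by
    simp only [Extension.mul_snd, Extension.add_snd, Extension.add_fst, mul_add, add_mul, map_add]
    abel
  right_distrib u v w := Extension.ext (add_mul _ _ _) fun c => by
    simp only [Extension.mul_snd, Extension.add_snd, Extension.add_fst, add_mul, map_add,
      LinearMap.add_apply]
    abel
  zero_mul u := Extension.ext (zero_mul _) fun c => by
    simp [Extension.mul_snd, Extension.zero_snd, Extension.zero_fst]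
  mul_zero u := Extension.ext (mul_zero _) fun c => by
    simp [Extension.mul_snd, Extension.zero_snd, Extension.zero_fst]
  one_mul u := Extension.ext (one_mul _) fun c => by
    simp [Extension.mul_snd, Extension.one_snd, Extension.one_fst, p.ψ_one_left]
  mul_one u := Extension.ext (mul_one _) fun c => by
    simp [Extension.mul_snd, Extension.one_snd, Extension.one_fst, p.ψ_one_right,
      mem_normalizedMaps.1 u.2.2]
  mul_assoc u v w := Extension.ext (mul_assoc _ _ _) fun c => by
    -- As `D(wc) - D(w)c = w D(c)`, the associator is the cocycle identity of `ψ` multiplied by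
    -- `D(c)`.
    have h := congrArg (· * p.D c) (p.cocycle u.1 v.1 w.1)
    simp only [add_mul, mul_assoc] at h
    simp only [Extension.mul_snd, Extension.mul_fst, map_mul, p.D_mul, mul_add, add_mul, mul_sub,
      sub_mul, mul_assoc]
    rw [← sub_eq_zero] at h ⊢
    rw [← neg_eq_zero, ← h]
    abel

instance : Algebra k p.Extension :=
  Algebra.ofModule
    (fun r u v => Extension.ext (smul_mul_assoc _ _ _) fun c => by
      simp only [Extension.mul_snd, Extension.smul_snd, Extension.smul_fst, map_smul,
        LinearMap.smul_apply, smul_mul_assoc, smul_add, smul_sub])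
    (fun r u v => Extension.ext (mul_smul_comm _ _ _) fun c => by
      simp only [Extension.mul_snd, Extension.smul_snd, Extension.smul_fst, map_smul,
        smul_mul_assoc, mul_smul_comm, smul_add, smul_sub])

/-- The projection of the extension onto `A`. -/
def Extension.proj : p.Extension →ₐ[k] A where
  toFun u := u.1
  map_one' := rfl
  map_mul' _ _ := rfl
  map_zero' := rfl
  map_add' _ _ := rfl
  commutes' r := by
    rw [Algebra.algebraMap_eq_smul_one, Algebra.algebraMap_eq_smul_one]
    rfl

variable (p)

/-- A splitting of the extension yields a primitive of the cocycle `(a, b, c) ↦ ψ(a, b) D(c)`. -/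
theorem exists_primitive (g : A →ₐ[k] p.Extension) (hg : ∀ a, (g a).1 = a) :
    ∃ η : Cochain k A 2, ∀ a : Fin 3 → A,
      coboundary p.σ 2 η a = p.ψ (a 0) (a 1) * p.D (a 2) := by
  -- Multiplicativity of `g` in its second component says that `-H(a)(b)`, as a 2-cochain, has
  -- coboundary `ψ(a, b) D(c)`.
  let H : A →ₗ[k] A →ₗ[k] A :=
    (normalizedMaps k A).subtype ∘ₗ LinearMap.snd k A (normalizedMaps k A) ∘ₗ g.toLinearMap
  have hH : ∀ a b c, H (a * b) c =
      p.σ a * H b c + H a (b * c) - H a b * c + p.ψ a b * p.D c := fun a b c => by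
    change (g (a * b)).2.1 c = _
    rw [map_mul, Extension.mul_snd, hg, hg]
    rfl
  let η : Cochain k A 2 :=
    -LinearMap.uncurryLeft
      ((MultilinearMap.ofSubsingletonₗ k k A A (0 : Fin 1)).toLinearMap ∘ₗ H)
  have hη : ∀ a : Fin 2 → A, η a = -H (a 0) (a 1) := fun a => rfl
  refine ⟨η, fun a => ?_⟩
  rw [coboundary_apply, Fin.sum_univ_two, hη, hη, hη, hη]
  simp [Fin.contractNth, Fin.tail, Fin.init, hH]
  rw [show (-1 : k) ^ 3 = -1 by ring, neg_smul, one_smul]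
  abel

end CocycleWithDerivation


/-! ### The splitting, and the vanishing of the cubic product. -/

/-- The 2-cocycle `∂_{-1} ⌣ ∂_1`, together with the derivation `∂_0`. -/
def cupWithDeriv (q : ℂˣ) : CocycleWithDerivation ℂ (Sphere q) where
  σ := twist q 1 * twist q (-1)
  ψ := (LinearMap.mul ℂ (Sphere q)).compl₁₂ ((twist q 1).toLinearMap ∘ₗ deriv q (-1)) (deriv q 1)
  D := deriv q 0
  D_mul := deriv_zero_mul q
  ψ_one_left a := by simp [deriv_one]
  ψ_one_right a := by simp [deriv_one]
  cocycle a b c := by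
    simp [deriv_mul, mul_add, mul_assoc]
    abel

theorem cupWithDeriv_σ_x (q : ℂˣ) :
    (cupWithDeriv q).σ (x q (-1)) = (q : ℂ) ^ 4 • x q (-1) ∧ (cupWithDeriv q).σ (x q 0) = x q 0 ∧
      (cupWithDeriv q).σ (x q 1) = ((q : ℂ) ^ 4)⁻¹ • x q 1 := by
  have e1 : twist q 1 (x q (-1)) = _ := twist_apply_neg q 1 (by decide)
  have e3 : twist q 1 (x q 1) = _ := twist_apply_pos q 1 (by decide)
  refine ⟨?_, ?_, ?_⟩ <;>
    simp only [cupWithDeriv, AlgEquiv.mul_apply, twist_neg_one, e1, e3, twist_apply_zero, map_smul,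
      smul_smul]
  · congr 1; ring
  · congr 1; rw [← mul_inv]; congr 1; ring

theorem cupWithDeriv_ψ (q : ℂˣ) (a b : Sphere q) :
    (cupWithDeriv q).ψ a b = twist q 1 (deriv q (-1) a) * deriv q 1 b := rfl

theorem cupWithDeriv_D (q : ℂˣ) : (cupWithDeriv q).D = deriv q 0 := rfl

/-- The second components of lifts of the generators to the extension. -/
def splittingMap (q : ℂˣ) : SignType → (Sphere q →ₗ[ℂ] Sphere q)
  | .neg => (-((q : ℂ) ^ 2 / ((q : ℂ) ^ 2 - 1))) • lower q
  | .zero => LinearMap.mulLeft ℂ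
      ((-(((q : ℂ) ^ 2)⁻¹ / ((q : ℂ) ^ 2 - 1))) • ((q : ℂ) • 1 + x q 0)) ∘ₗ deriv q 0
  | .pos => LinearMap.mulLeft ℂ
      ((((q : ℂ) ^ 4)⁻¹ - 2 * ((q : ℂ) ^ 2)⁻¹ / ((q : ℂ) ^ 2 - 1)) • x q 1) ∘ₗ deriv q 0
        - (((q : ℂ) ^ 2)⁻¹ / ((q : ℂ) ^ 2 - 1)) • raise q

theorem splittingMap_neg (q : ℂˣ) (c : Sphere q) : splittingMap q (-1) c =
    (-((q : ℂ) ^ 2 / ((q : ℂ) ^ 2 - 1))) • lower q c := rfl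

theorem splittingMap_zero (q : ℂˣ) (c : Sphere q) : splittingMap q 0 c =
    ((-(((q : ℂ) ^ 2)⁻¹ / ((q : ℂ) ^ 2 - 1))) • ((q : ℂ) • 1 + x q 0)) * deriv q 0 c := rfl

theorem splittingMap_pos (q : ℂˣ) (c : Sphere q) : splittingMap q 1 c =
    ((((q : ℂ) ^ 4)⁻¹ - 2 * ((q : ℂ) ^ 2)⁻¹ / ((q : ℂ) ^ 2 - 1)) • x q 1) * deriv q 0 c
        - (((q : ℂ) ^ 2)⁻¹ / ((q : ℂ) ^ 2 - 1)) • raise q c := rfl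

theorem splittingMap_mem (q : ℂˣ) (i : SignType) : splittingMap q i ∈ normalizedMaps ℂ (Sphere q) := by
  rw [mem_normalizedMaps]
  obtain rfl | rfl | rfl : i = -1 ∨ i = 0 ∨ i = 1 := by revert i; decide
  · rw [splittingMap_neg, lower_one, smul_zero]
  · rw [splittingMap_zero, deriv_one, mul_zero]
  · rw [splittingMap_pos, deriv_one, raise_one, mul_zero, smul_zero, sub_zero]

/-- Lifts of the generators to the extension. -/
def splittingGen (q : ℂˣ) (i : SignType) : (cupWithDeriv q).Extension :=
  (x q i, ⟨splittingMap q i, splittingMap_mem q i⟩)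

theorem x_neg_zero_mul (q : ℂˣ) (c : Sphere q) :
    x q (-1) * (x q 0 * c) = (q : ℂ) ^ 2 • (x q 0 * (x q (-1) * c)) := by
  rw [← mul_assoc, x_neg_zero, smul_mul_assoc, mul_assoc]

theorem x_pos_zero_mul (q : ℂˣ) (c : Sphere q) :
    x q 1 * (x q 0 * c) = ((q : ℂ) ^ 2)⁻¹ • (x q 0 * (x q 1 * c)) := by
  rw [← mul_assoc, x_pos_zero, smul_mul_assoc, mul_assoc]

theorem x_pos_neg_mul (q : ℂˣ) (c : Sphere q) :
    x q 1 * (x q (-1) * c) =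
      ((q : ℂ) ^ 2)⁻¹ • (x q 0 * (x q 0 * c)) + (q : ℂ)⁻¹ • (x q 0 * c) := by
  rw [← mul_assoc, x_pos_neg, add_mul, smul_mul_assoc, mul_assoc, smul_mul_assoc]

theorem x_neg_pos_mul (q : ℂˣ) (c : Sphere q) :
    x q (-1) * (x q 1 * c) =
      (q : ℂ) ^ 2 • (x q 0 * (x q 0 * c)) + (q : ℂ) • (x q 0 * c) := by
  rw [← mul_assoc, x_neg_pos, add_mul, smul_mul_assoc, mul_assoc, smul_mul_assoc]

theorem lower_zero (q : ℂˣ) : lower q (x q 0) = 0 := by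
  simpa [lower_one] using lower_zero_mul q 1

theorem raise_zero (q : ℂˣ) : raise q (x q 0) = 0 := by
  simpa [raise_one] using raise_zero_mul q 1

theorem raise_neg (q : ℂˣ) : raise q (x q (-1)) = 0 := by
  simpa [lower_one, deriv_one] using raise_neg_mul q 1

theorem lower_pos (q : ℂˣ) : lower q (x q 1) = 1 + (q : ℂ) • x q 0 := by
  simpa [raise_one, deriv_one] using lower_pos_mul q 1

/-- The `lower` and `raise` terms cancel by their commutation with `x_0`. What remains are multiples
of `∂_0`. With `b (q + x_0) ∂_0` over `x_0`, the relation for `x_{-1}` reads `q⁵ b + q = q³ b` in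
lowest order, which yields `b = -q^{-2}/(q² - 1)`. -/
theorem splittingGen_comm (q : ℂˣ) (hq : (q : ℂ) ^ 2 - 1 ≠ 0) (s : SignType) (hs : s ≠ 0) :
    splittingGen q s * splittingGen q 0 =
      (q : ℂ) ^ (-2 * (s : ℤ)) • (splittingGen q 0 * splittingGen q s) := by
  have hq0 := q.ne_zero
  refine CocycleWithDerivation.Extension.ext (x_comm q s hs) fun c => ?_
  obtain ⟨s1, s2, s3⟩ := cupWithDeriv_σ_x q
  have e3 : twist q 1 (x q 1) = _ := twist_apply_pos q 1 (by decide)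
  have e5 : (q : ℂ) ^ (-2 * ((1 : SignType) : ℤ)) = ((q : ℂ) ^ 2)⁻¹ := by congr 1
  have e6 : (q : ℂ) ^ (-2 * ((-1 : SignType) : ℤ)) = (q : ℂ) ^ 2 := by simp
  rw [CocycleWithDerivation.Extension.smul_snd]
  simp only [CocycleWithDerivation.Extension.mul_snd]
  obtain rfl | rfl : s = -1 ∨ s = 1 := by revert s; decide
  all_goals
    simp only [splittingGen, s1, s2, s3, e3, e5, e6, cupWithDeriv_ψ, cupWithDeriv_D, deriv_x,
      derivValue_neg_neg, derivValue_neg_zero, derivValue_neg_pos, derivValue_zero_neg,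
      derivValue_zero_zero, derivValue_zero_pos, derivValue_pos_neg, derivValue_pos_zero,
      derivValue_pos_pos, splittingMap_neg, splittingMap_zero, splittingMap_pos, map_smul, map_add,
      map_zero, map_one, twist_apply_zero, deriv_zero_mul, lower_zero_mul, raise_zero_mul,
      lower_zero, raise_zero]
    simp only [mul_zero, zero_mul, add_zero, smul_zero, sub_zero, mul_add, add_mul,
      mul_sub, sub_mul, mul_one, one_mul, smul_mul_assoc, mul_smul_comm, smul_smul, smul_add,
      smul_sub, mul_neg, neg_mul, mul_assoc, x_neg_zero_mul, x_pos_zero_mul]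
  all_goals
    match_scalars
  all_goals
    try field_simp
  all_goals
    try ring

/-- The coefficient of `lower` is `q⁴` times that of `raise`, which compensates the scaling by `σ`,
so after the exchange rules both operators drop out. In the relation for `x_1 x_{-1}`, the constant
terms before `∂_0` make the coefficient of `raise` equal to `b`, the coefficient over `x_0`. The
terms in `x_0²` make that of `x_1 ∂_0` equal to `2b + q^{-4}`, with `q^{-4}` coming from `ψ(x_0,
x_0)`. -/
theorem splittingGen_sphere (q : ℂˣ) (hq : (q : ℂ) ^ 2 - 1 ≠ 0) (s : SignType) (hs : s ≠ 0) :
    splittingGen q s * splittingGen q (-s) =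
      (q : ℂ) ^ (-2 * (s : ℤ)) • splittingGen q 0 ^ 2 + (q : ℂ) ^ (-(s : ℤ)) • splittingGen q 0 := by
  have hq0 := q.ne_zero
  rw [pow_two]
  refine CocycleWithDerivation.Extension.ext
    ((x_sphere q s hs).trans (by rw [pow_two]; rfl)) fun c => ?_
  obtain ⟨s1, s2, s3⟩ := cupWithDeriv_σ_x q
  have e3 : twist q 1 (x q 1) = _ := twist_apply_pos q 1 (by decide)
  have e5 : (q : ℂ) ^ (-2 * ((1 : SignType) : ℤ)) = ((q : ℂ) ^ 2)⁻¹ := by congr 1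
  have e6 : (q : ℂ) ^ (-2 * ((-1 : SignType) : ℤ)) = (q : ℂ) ^ 2 := by simp
  have e7 : (q : ℂ) ^ (-((1 : SignType) : ℤ)) = (q : ℂ)⁻¹ := by simp
  have e8 : (q : ℂ) ^ (-((-1 : SignType) : ℤ)) = (q : ℂ) := by simp
  rw [CocycleWithDerivation.Extension.add_snd, CocycleWithDerivation.Extension.smul_snd,
    CocycleWithDerivation.Extension.smul_snd]
  simp only [CocycleWithDerivation.Extension.mul_snd]
  obtain rfl | rfl : s = -1 ∨ s = 1 := by revert s; decide
  all_goals
    simp only [splittingGen, neg_neg, s1, s2, s3, e3, e5, e6, e7, e8, cupWithDeriv_ψ,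
      cupWithDeriv_D, deriv_x, derivValue_neg_neg, derivValue_neg_zero, derivValue_neg_pos,
      derivValue_zero_neg, derivValue_zero_zero, derivValue_pos_neg, derivValue_pos_zero,
      derivValue_pos_pos, splittingMap_neg, splittingMap_zero, splittingMap_pos, map_smul, map_add,
      map_zero, map_one, twist_apply_zero, deriv_zero_mul, raise_neg_mul, lower_pos_mul, raise_neg,
      lower_pos]
    simp only [mul_zero, zero_mul, add_zero, smul_zero, sub_zero, mul_add, add_mul,
      mul_sub, sub_mul, mul_one, one_mul, smul_mul_assoc, mul_smul_comm, smul_smul, smul_add,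
      smul_sub, mul_neg, neg_mul, mul_assoc, x_pos_neg_mul, x_neg_pos_mul]
  all_goals
    match_scalars
  all_goals
    try field_simp
  all_goals
    try ring

/-- The splitting of the extension that belongs to `∂_{-1} ⌣ ∂_1 ⌣ ∂_0`. -/
def splitting (q : ℂˣ) (hq : (q : ℂ) ^ 2 - 1 ≠ 0) : Sphere q →ₐ[ℂ] (cupWithDeriv q).Extension :=
  lift q (splittingGen q) (splittingGen_comm q hq) (splittingGen_sphere q hq)

theorem splitting_fst (q : ℂˣ) (hq : (q : ℂ) ^ 2 - 1 ≠ 0) (a : Sphere q) :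
    (splitting q hq a).1 = a := by
  have : CocycleWithDerivation.Extension.proj.comp (splitting q hq) = AlgHom.id ℂ _ :=
    hom_ext fun i => by
      rw [AlgHom.comp_apply, splitting, lift_x]
      rfl
  exact DFunLike.congr_fun this a

/-- The factor `∂_0` stands last because the extension requires an untwisted derivation in the last
argument. The ordered product then follows by anticommuting `[∂_0]` and `[∂_1]`. -/
theorem derivClass_neg_pos_zero (q : ℂˣ) (hq : (q : ℂ) ^ 2 - 1 ≠ 0) :
    derivClass q (-1) * derivClass q 1 * derivClass q 0 = 0 := by
  rw [derivClass, derivClass, derivClass, cohomologyClass_mul, cohomologyClass_mul,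
    cohomologyClass_eq_zero_iff]
  obtain ⟨η, hη⟩ := (cupWithDeriv q).exists_primitive (splitting q hq) (splitting_fst q hq)
  have hσ : twist q 0 * (twist q 1 * twist q (-1)) = (cupWithDeriv q).σ := by
    rw [twist_zero, one_mul]
    rfl
  refine ⟨η, MultilinearMap.ext fun a => ?_⟩
  rw [← hσ] at hη
  refine (hη a).trans ?_
  change _ = cup (twist q 0) (cup (twist q 1) (derivCocycle q (-1)).1 (derivCocycle q 1).1)
    (derivCocycle q 0).1 a
  have h₀ : ∀ b, twist q 0 b = b := fun b => by rw [twist_zero]; rfl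
  rw [cup_apply, cup_apply, h₀]
  rfl

theorem derivClass_neg_zero_pos (q : ℂˣ) (hq : (q : ℂ) ^ 2 - 1 ≠ 0) :
    derivClass q (-1) * derivClass q 0 * derivClass q 1 = 0 := by
  have h := derivClass_mul q 0 1
  simp only [SignType.coe_zero, mul_zero, zpow_zero, one_smul] at h
  rw [mul_assoc, h, mul_neg, ← mul_assoc, derivClass_neg_pos_zero q hq, neg_zero]

end Podles

end

theorem mainTheorem1 (q : ℂˣ) (hq : ∀ n : ℕ, 0 < n → (q : ℂ) ^ n ≠ 1) :
    (∀ i j : SignType, i ≤ j →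
      Podles.derivClass q i * Podles.derivClass q j =
        -((q : ℂ) ^ (2 * (i : ℤ) * (j : ℤ)) • (Podles.derivClass q j * Podles.derivClass q i))) ∧
    (∀ i : SignType, Podles.derivClass q i * Podles.derivClass q i = 0) ∧
    Podles.derivClass q 1 * Podles.derivClass q (-1)
      + (q : ℂ) ^ 2 • (Podles.derivClass q (-1) * Podles.derivClass q 1) = 0 ∧
    TwoSidedIdeal.ker (FreeAlgebra.lift ℂ (Podles.derivClass q)) =
      TwoSidedIdeal.span
        ({r : FreeAlgebra ℂ SignType | ∃ i j : SignType, i ≤ j ∧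
            r = FreeAlgebra.ι ℂ i * FreeAlgebra.ι ℂ j
              + (q : ℂ) ^ (2 * (i : ℤ) * (j : ℤ)) • (FreeAlgebra.ι ℂ j * FreeAlgebra.ι ℂ i)} ∪
          {FreeAlgebra.ι ℂ (-1) * FreeAlgebra.ι ℂ 0 * FreeAlgebra.ι ℂ 1}) := by
  -- That `q` is not a root of unity enters through `q⁴ ≠ 1` for the squares and `q² ≠ 1` for the
  -- separation of degrees and the denominators of the splitting.
  have h4 := hq 4 (by norm_num)
  have h2 := hq 2 (by norm_num)
  have hle := Podles.derivClass_mul_of_le q h4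
  obtain ⟨hself, -, -, hpn⟩ := Podles.relations_of_exteriorRelations q h4 _ hle
  refine ⟨hle, hself, ?_, Podles.ker_lift_eq_span q h4 _ hle
    (Podles.derivClass_neg_zero_pos q (sub_ne_zero.2 h2))
    (Podles.derivClass_mul_linearIndependent q h2)⟩
  rw [hpn, neg_smul, neg_add_cancel]
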